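/- Let $p\in[0,1)$ and let $k\in\{1,3\}$. Put $P_k(y)=\sum_{h>k/2}\binom kh y^h(1-y)^{k-h}$ (so $P_1(y)=y$ and $P_3(y)=3y^2-2y^3$) and $$\pi_k(y)=p\,P_k(y)+(1-p)\bigl(1-P_k(y)\bigr),\qquad y\in[0,1].$$ Consider the urn process $Y_1,Y_2,\dots\in\{0,1\}$ with density $y_N=\frac1N\sum_{n\le N}Y_n$, started from an arbitrary fixed history $(Y_1,\dots,Y_M)$, $1\le M<\infty$, in which for $N\ge M$, given the history up to time $N$, $Y_{N+1}=1$ with probability $\pi_k(y_N)$ and $Y_{N+1}=0$ otherwise. (This is the elephant random walk with $k$ extractions, under $X_n=2Y_n-1$.) Then there is a function $\phi:[0,1]\to[-\infty,0]$, depending only on $k$ and $p$ and finite on $(0,1)$, such that, with $\log 0=-\infty$, $$\phi(y)=\lim_{N\to\infty}\frac1N\log P\bigl(y_N=\lfloor yN\rfloor/N\bigr)$$ for every $y\in[0,1]$ and every initial history, except that for $y=0$ (respectively $y=1$) and an initial history containing a $1$ (respectively a $0$) the probability eventually vanishes and the limit is $-\infty$. Moreover: 1. If $k=1$, or if $k=3$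 and $p\le p_c=5/6$, then $\phi(1/2)=0$ and $\phi(y)<0$ for all $y\in[0,1]\setminus\{1/2\}$. 2. If $k=3$ and $p>p_c=5/6$, then the solutions in $[0,1]$ of $\pi_3(y)=y$ are exactly $1/2$ and $$y_\pm(p)=\frac12\pm\frac12\sqrt{\frac{6p-5}{2p-1}},\qquad 0<y_-(p)<\tfrac12<y_+(p)<1,$$ and $\phi(y)=0$ for all $y\in[y_-(p),y_+(p)]$ (so that $\log P(y_N=\lfloor yN\rfloor/N)=o(N)$ there), while $\phi(y)<0$ for all $y\in[0,1]\setminus[y_-(p),y_+(p)]$. -/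

import Mathlib

open Set Filter Topology
open scoped unitInterval

namespace ElephantUrn

noncomputable section

/-- The polynomial `∑_{h > k/2} (k choose h) y^h (1 - y)^(k - h)`, the probability of a majority of
positive steps among `k` extractions, each of which is positive with probability `y`. -/
def majorityPoly (k : ℕ) (y : ℝ) : ℝ :=
  ∑ h ∈ (Finset.range (k + 1)).filter (fun h => k < 2 * h),
    (k.choose h : ℝ) * y ^ h * (1 - y) ^ (k - h)

theorem majorityPoly_mem (k : ℕ) (y : I) : majorityPoly k y ∈ I := by
  have h0 : (0 : ℝ) ≤ y := y.2.1
  have h1 : (0 : ℝ) ≤ 1 - y := sub_nonneg.2 y.2.2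
  have hnn : ∀ h : ℕ, 0 ≤ (k.choose h : ℝ) * (y : ℝ) ^ h * (1 - (y : ℝ)) ^ (k - h) := fun h => by
    positivity
  refine ⟨Finset.sum_nonneg fun h _ => hnn h, ?_⟩
  calc majorityPoly k y
      ≤ ∑ h ∈ Finset.range (k + 1),
          (k.choose h : ℝ) * (y : ℝ) ^ h * (1 - (y : ℝ)) ^ (k - h) :=
        Finset.sum_le_sum_of_subset_of_nonneg (Finset.filter_subset _ _) fun h _ _ => hnn h
    _ = ((y : ℝ) + (1 - y)) ^ k := by
        rw [add_pow]
        exact Finset.sum_congr rfl fun h _ => by ring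
    _ = 1 := by simp

/-- The urn function `π_k(y) = p P_k(y) + (1 - p) (1 - P_k(y))` of the walk with `k` extractions
and memory parameter `p`. -/
def urnFunction (k : ℕ) (p y : I) : I :=
  ⟨(p : ℝ) * majorityPoly k y + (1 - (p : ℝ)) * (1 - majorityPoly k y), by
    obtain ⟨hP0, hP1⟩ := majorityPoly_mem k y
    obtain ⟨hp0, hp1⟩ := p.2
    constructor <;> nlinarith [mul_nonneg hp0 hP0,
      mul_nonneg (sub_nonneg.2 hp1) (sub_nonneg.2 hP1), mul_nonneg hp0 (sub_nonneg.2 hP1),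
      mul_nonneg (sub_nonneg.2 hp1) hP0]⟩

/-- The density of black balls (`true`) in a sequence of balls. -/
def density (Y : List Bool) : I :=
  ⟨(Y.count true : ℝ) / (Y.length : ℝ),
    unitInterval.div_mem (Nat.cast_nonneg _) (Nat.cast_nonneg _)
      (Nat.cast_le.2 List.count_le_length)⟩

/-- The law of the colour of a ball that is black (`true`) with probability `q` and white
otherwise. -/
def ballLaw (q : I) : PMF Bool :=
  PMF.ofFintype (fun b => bif b then ENNReal.ofReal q else ENNReal.ofReal (1 - (q : ℝ))) (by
    simp only [Fintype.sum_bool, cond_true, cond_false]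
    rw [← ENNReal.ofReal_add q.2.1 (sub_nonneg.2 q.2.2)]
    simp)

/-- One step of the Hill-Lane-Sudderth urn with urn function `π`: a ball is added, black with
probability `π(y)` and white otherwise, where `y` is the present density of black balls. The most
recent ball is the head of the list. -/
def urnStep (π : I → I) (Y : List Bool) : PMF (List Bool) :=
  (ballLaw (π (density Y))).map (fun b => b :: Y)

/-- The law of the history of the urn after `t` further steps from the initial history `init`. -/
def urnLaw (π : I → I) (init : List Bool) : ℕ → PMF (List Bool)
  | 0 => PMF.pure init
  | t + 1 => (urnLaw π init t).bind (urnStep π)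

/-- `P(y_N = ⌊y N⌋ / N)` for the urn with urn function `π` whose history at the time
`M = init.length` is `init`; meant for times `N ≥ M`. -/
def densityProb (π : I → I) (init : List Bool) (y : ℝ) (N : ℕ) : ENNReal :=
  ((urnLaw π init (N - init.length)).map (fun Y => (density Y : ℝ))) ((⌊y * N⌋ : ℝ) / (N : ℝ))

/-- The extended real number `ℓ` is the limit of `N⁻¹ log P(y_N = ⌊y N⌋ / N)` as `N → ∞`
(with `log 0 = -∞`). -/
def HasEntropyDensity (π : I → I) (init : List Bool) (y : ℝ) (ℓ : EReal) : Prop :=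
  Tendsto (fun N : ℕ => ENNReal.log (densityProb π init y N) / ((N : ℝ) : EReal)) atTop (𝓝 ℓ)

/-- `y_-(p)`. -/
def yMinus (p : ℝ) : ℝ := 1 / 2 - 1 / 2 * √((6 * p - 5) / (2 * p - 1))

/-- `y_+(p)`. -/
def yPlus (p : ℝ) : ℝ := 1 / 2 + 1 / 2 * √((6 * p - 5) / (2 * p - 1))

end

end ElephantUrn

/-!
The number of black balls is a Markov chain, whose transition probabilities are called `trans`. The
property of the urn function `π` behind the existence of the entropy density is
`IsRegularUrn.scale`: if the proportion of each colour is multiplied by at least `c`, then the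
probability of each colour is multiplied by at least `c ^ k`. It holds because `π` and `1 - π` are
polynomials of degree `k` with nonnegative coefficients in the Bernstein basis, and it controls `π`
near `0` and `1`, where for `p = 0` the logarithms of the probabilities are unbounded.

*Existence of the limit.* A path of the urn can be magnified by a large integer. Mixed with a small
proportion of a path of constant density `y`, it stays at interior densities close to the original
ones, so that the magnified path has almost the corresponding power of the original probability;
the number of paths is taken care of by `choose l r ^ m ≤ choose (m * l) (m * r)`, applied to
stretches of a bounded length `l`. Hence the rate `N⁻¹ log P` at a large time `N` almost bounds from
below the rate at all much larger times, whatever the two initial histories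
(`trans_pow_le_trans_magnified`, `rate_sub_le_rate`), and the upper limit for one history is at most
the lower limit for the other (`exists_tendsto_rate`). At `y = 0` and `y = 1` the event consists of
a single history and its probability is explicit.

*Zeros.* An Euler step of size `ε` along the drift, `(1 + ε) y = x + ε π(x)`, costs only `O(ε ^ 2)`,
so that `φ(x) - O(ε ^ 2) ≤ (1 + ε) φ(y)` (`euler_step_le`). Between two fixed points of `π` in
`(0, 1)` every `y` arises from an `x` in the same interval, by the intermediate value theorem. The
infimum of `φ` over the interval is then at least `-O(ε)` for every `ε`, hence zero
(`rate_limit_eq_zero`).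

*Negativity.* If `π(z) < z` for all `z > y₀`, then the densities above any `b > y₀` are
exponentially unlikely: this is void for `b > 1` and spreads downwards in steps of a fixed size by
Chernoff's bound (`TailDecay.step`, `tailDecay_of_lt`). Exchanging the colours, which preserves `π`,
gives the same below `1 - y₀`. The theorem follows with `y₀ = 1 / 2` up to the critical value and
with `y₀ = y_+(p)` above it.
-/

namespace ElephantUrn

/-! ### Transition probabilities of the number of black balls -/

/-- `trans f n s t s'` is the probability that the urn with urn function `f`, holding `n` balls of
which `s` are black, holds `s'` black balls after `t` further steps. The recursion conditions on
the first of these steps. For `n = 0` the density is read as `0`; all uses have `n > 0`. -/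
noncomputable def trans (f : ℝ → ℝ) : ℕ → ℕ → ℕ → ℕ → ℝ
  | _, s, 0, s' => if s = s' then 1 else 0
  | n, s, t + 1, s' => f ((s : ℝ) / (n : ℝ)) * trans f (n + 1) (s + 1) t s' +
      (1 - f ((s : ℝ) / (n : ℝ))) * trans f (n + 1) s t s'

/-- A continuous urn function for which the urn leaves either monochromatic state with positive
probability, and the probability of each colour is multiplied by at least `c ^ k` when the
proportion of each colour is multiplied by at least `c`. The latter holds for polynomials of degree `k` with nonnegative coefficients in the
Bernstein basis. -/
structure IsRegularUrn (f : ℝ → ℝ) (k : ℕ) : Prop where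
  nonneg : ∀ x, 0 ≤ x → x ≤ 1 → 0 ≤ f x
  le_one : ∀ x, 0 ≤ x → x ≤ 1 → f x ≤ 1
  zero_pos : 0 < f 0
  one_lt : f 1 < 1
  scale : ∀ u v c : ℝ, 0 ≤ u → u ≤ 1 → 0 ≤ c → c * u ≤ v → c * (1 - u) ≤ 1 - v →
    c ^ k * f u ≤ f v ∧ c ^ k * (1 - f u) ≤ 1 - f v
  cont : Continuous f

variable {f : ℝ → ℝ} {k : ℕ}

theorem div_mem_unit {s n : ℕ} (h : s ≤ n) : 0 ≤ (s : ℝ) / n ∧ (s : ℝ) / n ≤ 1 :=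
  ⟨by positivity, div_le_one_of_le₀ (by exact_mod_cast h) (by positivity)⟩

theorem IsRegularUrn.pos (hf : IsRegularUrn f k) {x : ℝ} (h0 : 0 ≤ x) (h1 : x < 1) : 0 < f x := by
  have := (hf.scale 0 x (1 - x) le_rfl zero_le_one (by linarith) (by simpa) (by simp)).1
  have h2 : 0 < (1 - x) ^ k * f 0 := mul_pos (pow_pos (by linarith) _) hf.zero_pos
  linarith

theorem IsRegularUrn.lt_one (hf : IsRegularUrn f k) {x : ℝ} (h0 : 0 < x) (h1 : x ≤ 1) :
    f x < 1 := by
  have := (hf.scale 1 x x zero_le_one le_rfl h0.le (by simp) (by simpa using h1)).2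
  have h2 : 0 < x ^ k * (1 - f 1) := mul_pos (pow_pos h0 _) (sub_pos.2 hf.one_lt)
  linarith

theorem IsRegularUrn.frac_nonneg (hf : IsRegularUrn f k) {s n : ℕ} (h : s ≤ n) :
    0 ≤ f ((s : ℝ) / n) :=
  hf.nonneg _ (div_mem_unit h).1 (div_mem_unit h).2

theorem IsRegularUrn.frac_le_one (hf : IsRegularUrn f k) {s n : ℕ} (h : s ≤ n) :
    0 ≤ 1 - f ((s : ℝ) / n) :=
  sub_nonneg.2 (hf.le_one _ (div_mem_unit h).1 (div_mem_unit h).2)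

theorem trans_nonneg (hf : IsRegularUrn f k) (t : ℕ) :
    ∀ {n s : ℕ} (s' : ℕ), s ≤ n → 0 ≤ trans f n s t s' := by
  induction t with
  | zero => intro n s s' _; simp only [trans]; split_ifs <;> norm_num
  | succ t ih =>
    intro n s s' h
    simp only [trans]
    exact add_nonneg (mul_nonneg (hf.frac_nonneg h) (ih _ (by omega)))
      (mul_nonneg (hf.frac_le_one h) (ih _ (by omega)))

theorem trans_le_one (hf : IsRegularUrn f k) (t : ℕ) :
    ∀ {n s : ℕ} (s' : ℕ), s ≤ n → trans f n s t s' ≤ 1 := by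
  induction t with
  | zero => intro n s s' _; simp only [trans]; split_ifs <;> norm_num
  | succ t ih =>
    intro n s s' h
    simp only [trans]
    have h1 := mul_le_mul_of_nonneg_left (ih (n := n + 1) (s := s + 1) s' (by omega))
      (hf.frac_nonneg h)
    have h2 := mul_le_mul_of_nonneg_left (ih (n := n + 1) (s := s) s' (by omega))
      (hf.frac_le_one h)
    linarith

theorem trans_eq_zero_of_lt (f : ℝ → ℝ) (t : ℕ) :
    ∀ {n s s' : ℕ}, s' < s → trans f n s t s' = 0 := by
  induction t with
  | zero => intro n s s' h; simp [trans, h.ne']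
  | succ t ih =>
    intro n s s' h
    simp [trans, ih (n := n + 1) h, ih (n := n + 1) (h.trans s.lt_succ_self)]

theorem trans_eq_zero_of_gt (f : ℝ → ℝ) (t : ℕ) :
    ∀ {n s s' : ℕ}, s + t < s' → trans f n s t s' = 0 := by
  induction t with
  | zero => intro n s s' h; simp [trans, show s ≠ s' by omega]
  | succ t ih =>
    intro n s s' h
    simp [trans, ih (n := n + 1) (s := s) (s' := s') (by omega),
      ih (n := n + 1) (s := s + 1) (s' := s') (by omega)]

theorem trans_pos (hf : IsRegularUrn f k) (t : ℕ) :
    ∀ {n s r : ℕ}, 0 < s → s < n → r ≤ t → 0 < trans f n s t (s + r) := by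
  induction t with
  | zero => intro n s r _ _ h; obtain rfl : r = 0 := by omega
            simp [trans]
  | succ t ih =>
    intro n s r hs hn hr
    have hn' : (0 : ℝ) < n := by exact_mod_cast (by omega : 0 < n)
    have h1 : (s : ℝ) / n < 1 := (div_lt_one hn').2 (by exact_mod_cast hn)
    have h0 : 0 < (s : ℝ) / n := by positivity
    simp only [trans]
    rcases Nat.lt_or_ge t r with h | h
    · obtain rfl : r = t + 1 := by omega
      have := ih (n := n + 1) (s := s + 1) (r := t) (by omega) (by omega) le_rfl
      rw [show s + (t + 1) = s + 1 + t by omega]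
      exact add_pos_of_pos_of_nonneg (mul_pos (hf.pos h0.le h1) this)
        (mul_nonneg (hf.frac_le_one hn.le) (trans_nonneg hf _ _ (by omega)))
    · exact add_pos_of_nonneg_of_pos
        (mul_nonneg (hf.frac_nonneg hn.le) (trans_nonneg hf _ _ (by omega)))
        (mul_pos (sub_pos.2 (hf.lt_one h0 h1.le)) (ih hs (by omega) h))

theorem trans_add (f : ℝ → ℝ) (a b : ℕ) : ∀ n s s'' : ℕ, trans f n s (a + b) s'' =
    ∑ s' ∈ Finset.range (s'' + 1), trans f n s a s' * trans f (n + a) s' b s'' := by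
  induction a with
  | zero =>
    intro n s s''
    simp only [trans, ite_mul, one_mul, zero_mul, Finset.sum_ite_eq, Finset.mem_range, zero_add,
      add_zero]
    split_ifs with h
    · rfl
    · exact trans_eq_zero_of_lt f b (by omega)
  | succ a ih =>
    intro n s s''
    rw [show a + 1 + b = (a + b) + 1 by omega]
    simp only [trans, ih, add_mul, Finset.sum_add_distrib, Finset.mul_sum, mul_assoc]
    rw [show n + (a + 1) = n + 1 + a by omega]

/-- Chapman–Kolmogorov as a lower bound. -/
theorem mul_trans_le (hf : IsRegularUrn f k) {n s s' s'' a b : ℕ} (h : s ≤ n) :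
    trans f n s a s' * trans f (n + a) s' b s'' ≤ trans f n s (a + b) s'' := by
  rw [trans_add]
  rcases Nat.lt_or_ge s'' s' with h1 | h1
  · rw [trans_eq_zero_of_lt f b h1, mul_zero]
    refine Finset.sum_nonneg fun i _ => ?_
    rcases Nat.lt_or_ge (s + a) i with h2 | h2
    · simp [trans_eq_zero_of_gt f a h2]
    · exact mul_nonneg (trans_nonneg hf _ _ h) (trans_nonneg hf _ _ (by omega))
  · refine Finset.single_le_sum (f := fun i => trans f n s a i * trans f (n + a) i b s'')
      (fun i _ => ?_) (Finset.mem_range.2 (by omega))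
    rcases Nat.lt_or_ge (s + a) i with h2 | h2
    · simp [trans_eq_zero_of_gt f a h2]
    · exact mul_nonneg (trans_nonneg hf _ _ h) (trans_nonneg hf _ _ (by omega))

/-- Chapman–Kolmogorov as an upper bound: there are at most `b + 1` intermediate states. -/
theorem exists_trans_le (hf : IsRegularUrn f k) {n s : ℕ} (s'' a b : ℕ) (h : s ≤ n) :
    ∃ s', s' ≤ s'' ∧ s'' ≤ s' + b ∧
      trans f n s (a + b) s'' ≤ (b + 1 : ℝ) * (trans f n s a s' * trans f (n + a) s' b s'') := by
  have hsub : ∑ i ∈ Finset.range (s'' + 1), trans f n s a i * trans f (n + a) i b s'' =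
      ∑ i ∈ Finset.Icc (s'' - b) s'', trans f n s a i * trans f (n + a) i b s'' := by
    symm
    refine Finset.sum_subset (fun i hi => ?_) (fun i hi hi' => ?_)
    · simp only [Finset.mem_Icc, Finset.mem_range] at hi ⊢; omega
    · simp only [Finset.mem_Icc, Finset.mem_range] at hi hi'
      rw [trans_eq_zero_of_gt f b (s := i) (by omega), mul_zero]
  obtain ⟨s', hs', hmax⟩ := Finset.exists_max_image (Finset.Icc (s'' - b) s'')
    (fun i => trans f n s a i * trans f (n + a) i b s'') ⟨s'', by simp⟩
  have hs := Finset.mem_Icc.1 hs'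
  have hnn : 0 ≤ trans f n s a s' * trans f (n + a) s' b s'' := by
    rcases Nat.lt_or_ge (s + a) s' with h2 | h2
    · simp [trans_eq_zero_of_gt f a h2]
    · exact mul_nonneg (trans_nonneg hf _ _ h) (trans_nonneg hf _ _ (by omega))
  refine ⟨s', hs.2, by omega, ?_⟩
  rw [trans_add, hsub]
  refine (Finset.sum_le_card_nsmul _ _ _ hmax).trans ?_
  rw [nsmul_eq_mul]
  refine mul_le_mul_of_nonneg_right ?_ hnn
  rw [Nat.card_Icc]
  have : s'' + 1 - (s'' - b) ≤ b + 1 := by omega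
  exact_mod_cast this

/-! ### Binomial and exponential bounds -/

/-- A lower bound by a binomial weight, when `α` and `β` bound the probabilities of the two colours
from below at all densities that can be reached. -/
theorem choose_mul_le_trans (hf : IsRegularUrn f k) {α β : ℝ} (hα : 0 ≤ α) (hβ : 0 ≤ β) (t : ℕ) :
    ∀ {n s : ℕ} (r : ℕ), s ≤ n →
    (∀ j < t, ∀ i ≤ j, α ≤ f (((s + i : ℕ) : ℝ) / ((n + j : ℕ) : ℝ)) ∧
      β ≤ 1 - f (((s + i : ℕ) : ℝ) / ((n + j : ℕ) : ℝ))) →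
    (t.choose r : ℝ) * α ^ r * β ^ (t - r) ≤ trans f n s t (s + r) := by
  induction t with
  | zero =>
    intro n s r _ _
    rcases r with _ | r <;> simp [trans]
  | succ t ih =>
    intro n s r hsn hb
    have h0 := hb 0 (by omega) 0 le_rfl
    simp only [add_zero] at h0
    have hb1 : ∀ j < t, ∀ i ≤ j, α ≤ f (((s + 1 + i : ℕ) : ℝ) / ((n + 1 + j : ℕ) : ℝ)) ∧
        β ≤ 1 - f (((s + 1 + i : ℕ) : ℝ) / ((n + 1 + j : ℕ) : ℝ)) := fun j hj i hi => by
      have := hb (j + 1) (by omega) (i + 1) (by omega)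
      rwa [show s + (i + 1) = s + 1 + i by omega, show n + (j + 1) = n + 1 + j by omega] at this
    have hb2 : ∀ j < t, ∀ i ≤ j, α ≤ f (((s + i : ℕ) : ℝ) / ((n + 1 + j : ℕ) : ℝ)) ∧
        β ≤ 1 - f (((s + i : ℕ) : ℝ) / ((n + 1 + j : ℕ) : ℝ)) := fun j hj i hi => by
      have := hb (j + 1) (by omega) i (by omega)
      rwa [show n + (j + 1) = n + 1 + j by omega] at this
    have i2 := ih r (by omega) hb2
    simp only [trans]
    rcases r with _ | r
    · have e2 := mul_le_mul h0.2 i2 (by positivity) (hf.frac_le_one hsn)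
      have e1 : 0 ≤ f ((s : ℝ) / n) * trans f (n + 1) (s + 1) t (s + 0) :=
        mul_nonneg (hf.frac_nonneg hsn) (trans_nonneg hf _ _ (by omega))
      simp only [Nat.choose_zero_right, Nat.cast_one, pow_zero, mul_one, one_mul,
        Nat.sub_zero] at e2 ⊢
      rw [pow_succ']
      linarith
    · have i1 := ih r (by omega) hb1
      rw [show s + 1 + r = s + (r + 1) by omega] at i1
      have e1 := mul_le_mul h0.1 i1 (by positivity) (hf.frac_nonneg hsn)
      have e2 := mul_le_mul h0.2 i2 (by positivity) (hf.frac_le_one hsn)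
      refine le_trans (le_of_eq ?_) (add_le_add e1 e2)
      rw [Nat.choose_succ_succ, Nat.add_sub_add_right]
      rcases Nat.lt_or_ge t (r + 1) with h | h
      · rw [Nat.choose_eq_zero_of_lt h]; push_cast; ring
      · rw [show t - r = t - (r + 1) + 1 by omega]; push_cast; ring

/-- The upper bound matching `choose_mul_le_trans`. -/
theorem trans_le_choose_mul (hf : IsRegularUrn f k) {α β : ℝ} (hα : 0 ≤ α) (hβ : 0 ≤ β) (t : ℕ) :
    ∀ {n s : ℕ} (r : ℕ), s ≤ n →
    (∀ j < t, ∀ i ≤ j, f (((s + i : ℕ) : ℝ) / ((n + j : ℕ) : ℝ)) ≤ α ∧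
      1 - f (((s + i : ℕ) : ℝ) / ((n + j : ℕ) : ℝ)) ≤ β) →
    trans f n s t (s + r) ≤ (t.choose r : ℝ) * α ^ r * β ^ (t - r) := by
  induction t with
  | zero =>
    intro n s r _ _
    rcases r with _ | r <;> simp [trans]
  | succ t ih =>
    intro n s r hsn hb
    have h0 := hb 0 (by omega) 0 le_rfl
    simp only [add_zero] at h0
    have hb1 : ∀ j < t, ∀ i ≤ j, f (((s + 1 + i : ℕ) : ℝ) / ((n + 1 + j : ℕ) : ℝ)) ≤ α ∧
        1 - f (((s + 1 + i : ℕ) : ℝ) / ((n + 1 + j : ℕ) : ℝ)) ≤ β := fun j hj i hi => by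
      have := hb (j + 1) (by omega) (i + 1) (by omega)
      rwa [show s + (i + 1) = s + 1 + i by omega, show n + (j + 1) = n + 1 + j by omega] at this
    have hb2 : ∀ j < t, ∀ i ≤ j, f (((s + i : ℕ) : ℝ) / ((n + 1 + j : ℕ) : ℝ)) ≤ α ∧
        1 - f (((s + i : ℕ) : ℝ) / ((n + 1 + j : ℕ) : ℝ)) ≤ β := fun j hj i hi => by
      have := hb (j + 1) (by omega) i (by omega)
      rwa [show n + (j + 1) = n + 1 + j by omega] at this
    have i2 := ih r (by omega) hb2
    simp only [trans]
    rcases r with _ | r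
    · have e2 := mul_le_mul h0.2 i2 (trans_nonneg hf _ _ (by omega)) hβ
      rw [trans_eq_zero_of_lt f t (s := s + 1) (by omega)]
      simp only [Nat.choose_zero_right, Nat.cast_one, pow_zero, mul_one, one_mul,
        Nat.sub_zero] at e2 ⊢
      rw [pow_succ']
      linarith
    · have i1 := ih r (by omega) hb1
      rw [show s + 1 + r = s + (r + 1) by omega] at i1
      have e1 := mul_le_mul h0.1 i1 (trans_nonneg hf _ _ (by omega)) hα
      have e2 := mul_le_mul h0.2 i2 (trans_nonneg hf _ _ (by omega)) hβ
      refine (add_le_add e1 e2).trans (le_of_eq ?_)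
      rw [Nat.choose_succ_succ, Nat.add_sub_add_right]
      rcases Nat.lt_or_ge t (r + 1) with h | h
      · rw [Nat.choose_eq_zero_of_lt h]; push_cast; ring
      · rw [show t - r = t - (r + 1) + 1 by omega]; push_cast; ring

/-- Chernoff's bound: black balls are at least as rare as in Bernoulli trials with success
probability `q` while `q` bounds the urn function at all densities that can be reached. -/
theorem trans_mul_pow_le (hf : IsRegularUrn f k) {q x : ℝ} (hx : 1 ≤ x) (hq : 0 ≤ q) (t : ℕ) :
    ∀ {n s : ℕ} (r : ℕ), s ≤ n →
    (∀ j < t, ∀ i ≤ j, f (((s + i : ℕ) : ℝ) / ((n + j : ℕ) : ℝ)) ≤ q) →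
    trans f n s t (s + r) * x ^ r ≤ (1 + (x - 1) * q) ^ t := by
  have hbase : 0 ≤ (x - 1) * q := mul_nonneg (by linarith) hq
  induction t with
  | zero =>
    intro n s r _ _
    rcases r with _ | r <;> simp [trans]
  | succ t ih =>
    intro n s r hsn hb
    have h0 := hb 0 (by omega) 0 le_rfl
    simp only [add_zero] at h0
    have hb1 : ∀ j < t, ∀ i ≤ j, f (((s + 1 + i : ℕ) : ℝ) / ((n + 1 + j : ℕ) : ℝ)) ≤ q :=
      fun j hj i hi => by
      have := hb (j + 1) (by omega) (i + 1) (by omega)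
      rwa [show s + (i + 1) = s + 1 + i by omega, show n + (j + 1) = n + 1 + j by omega] at this
    have hb2 : ∀ j < t, ∀ i ≤ j, f (((s + i : ℕ) : ℝ) / ((n + 1 + j : ℕ) : ℝ)) ≤ q :=
      fun j hj i hi => by
      have := hb (j + 1) (by omega) i (by omega)
      rwa [show n + (j + 1) = n + 1 + j by omega] at this
    have i2 := mul_le_mul_of_nonneg_left (ih r (by omega) hb2) (hf.frac_le_one hsn)
    have hB : 0 ≤ (1 + (x - 1) * q) ^ t := by positivity
    have hfn := hf.frac_nonneg hsn
    have key : f ((s : ℝ) / n) * x + (1 - f ((s : ℝ) / n)) ≤ 1 + (x - 1) * q := by nlinarith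
    have key2 := mul_le_mul_of_nonneg_right key hB
    simp only [trans]
    rw [pow_succ']
    rcases r with _ | r
    · rw [trans_eq_zero_of_lt f t (s := s + 1) (by omega)]
      have : 0 ≤ f ((s : ℝ) / n) * x * (1 + (x - 1) * q) ^ t := by positivity
      simp only [pow_zero, mul_one, mul_zero, zero_add] at i2 ⊢
      linarith
    · have i1 := mul_le_mul_of_nonneg_left (ih r (by omega) hb1)
        (mul_nonneg hfn (by linarith : 0 ≤ x))
      rw [show s + 1 + r = s + (r + 1) by omega] at i1
      rw [pow_succ'] at i2 ⊢
      linarith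

theorem choose_mul_choose_le (a b c e : ℕ) :
    a.choose b * c.choose e ≤ (a + c).choose (b + e) := by
  rw [Nat.add_choose_eq]
  exact Finset.single_le_sum (f := fun ij : ℕ × ℕ => a.choose ij.1 * c.choose ij.2)
    (fun _ _ => Nat.zero_le _)
    (Finset.HasAntidiagonal.mem_antidiagonal.2 (rfl : (b, e).1 + (b, e).2 = b + e))

theorem choose_pow_le (a b m : ℕ) : (a.choose b) ^ m ≤ (m * a).choose (m * b) := by
  induction m with
  | zero => simp
  | succ m ih =>
    rw [pow_succ, add_mul, add_mul, one_mul, one_mul]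
    exact (Nat.mul_le_mul_right _ ih).trans (choose_mul_choose_le _ _ _ _)

/-- The most likely value of a binomial law with parameters `r + w` and `r / (r + w)` is `r`, so
that it has probability at least `1 / (r + w + 1)`. -/
theorem pow_le_choose_mul (r w : ℕ) :
    (r + w) ^ (r + w) ≤ (r + w + 1) * ((r + w).choose r * r ^ r * w ^ w) := by
  set T : ℕ → ℕ := fun j => r ^ j * w ^ (r + w - j) * (r + w).choose j with hT
  have hup : ∀ i ≤ r, T (r - i) ≤ T r := by
    intro i
    induction i with
    | zero => simp
    | succ i ih =>
      intro hi
      refine le_trans ?_ (ih (by omega))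
      obtain ⟨j, hj⟩ : ∃ j, r = j + (i + 1) := ⟨r - (i + 1), by omega⟩
      have e1 : r - (i + 1) = j := by omega
      have e2 : r - i = j + 1 := by omega
      simp only [hT, e1, e2]
      have hc := Nat.choose_succ_right_eq (r + w) j
      have e3 : r + w - j = (r + w - (j + 1)) + 1 := by omega
      have key : w * (r + w).choose j ≤ r * (r + w).choose (j + 1) := by
        refine Nat.le_of_mul_le_mul_right (c := j + 1) ?_ (by omega)
        rw [mul_assoc r, hc]
        have : w * (j + 1) ≤ r * (r + w - j) := by
          rw [mul_comm]; exact Nat.mul_le_mul (by omega) (by omega)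
        calc w * (r + w).choose j * (j + 1) = (r + w).choose j * (w * (j + 1)) := by ring
          _ ≤ (r + w).choose j * (r * (r + w - j)) := Nat.mul_le_mul_left _ this
          _ = _ := by ring
      rw [e3, pow_succ, pow_succ]
      calc r ^ j * (w ^ (r + w - (j + 1)) * w) * (r + w).choose j
          = r ^ j * w ^ (r + w - (j + 1)) * (w * (r + w).choose j) := by ring
        _ ≤ r ^ j * w ^ (r + w - (j + 1)) * (r * (r + w).choose (j + 1)) :=
          Nat.mul_le_mul_left _ key
        _ = _ := by ring
  have hdown : ∀ i ≤ w, T (r + i) ≤ T r := by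
    intro i
    induction i with
    | zero => simp
    | succ i ih =>
      intro hi
      refine le_trans ?_ (ih (by omega))
      rw [← add_assoc]
      simp only [hT]
      have hc := Nat.choose_succ_right_eq (r + w) (r + i)
      have e3 : r + w - (r + i) = (r + w - (r + i + 1)) + 1 := by omega
      have key : r * (r + w).choose (r + i + 1) ≤ w * (r + w).choose (r + i) := by
        refine Nat.le_of_mul_le_mul_right (c := r + i + 1) ?_ (by omega)
        rw [mul_assoc r, hc]
        have : r * (r + w - (r + i)) ≤ w * (r + i + 1) := by
          rw [mul_comm w]; exact Nat.mul_le_mul (by omega) (by omega)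
        calc r * ((r + w).choose (r + i) * (r + w - (r + i)))
            = (r + w).choose (r + i) * (r * (r + w - (r + i))) := by ring
          _ ≤ (r + w).choose (r + i) * (w * (r + i + 1)) := Nat.mul_le_mul_left _ this
          _ = _ := by ring
      rw [e3, pow_succ, pow_succ]
      calc r ^ (r + i) * r * w ^ (r + w - (r + i + 1)) * (r + w).choose (r + i + 1)
          = r ^ (r + i) * w ^ (r + w - (r + i + 1)) * (r * (r + w).choose (r + i + 1)) := by ring
        _ ≤ r ^ (r + i) * w ^ (r + w - (r + i + 1)) * (w * (r + w).choose (r + i)) :=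
          Nat.mul_le_mul_left _ key
        _ = _ := by ring
  rw [add_pow]
  refine (Finset.sum_le_card_nsmul _ _ (T r) fun j hj => ?_).trans (le_of_eq ?_)
  · rcases le_total j r with h | h
    · have := hup (r - j) (by omega)
      rwa [show r - (r - j) = j by omega] at this
    · have := hdown (j - r) (by have := Finset.mem_range.1 hj; omega)
      rwa [show r + (j - r) = j by omega] at this
  · rw [Finset.card_range, smul_eq_mul]
    simp only [hT, Nat.add_sub_cancel_left]
    ring

/-- `law f M s₀ N s` is the probability that the urn holds `s` black balls at the time `N`, when it
holds `s₀` black balls at the time `M`. It is meant for `M ≤ N`. -/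
noncomputable def law (f : ℝ → ℝ) (M s₀ N s : ℕ) : ℝ := trans f M s₀ (N - M) s

theorem law_nonneg (hf : IsRegularUrn f k) {M s₀ : ℕ} (h : s₀ ≤ M) (N s : ℕ) :
    0 ≤ law f M s₀ N s := trans_nonneg hf _ _ h

theorem law_le_one (hf : IsRegularUrn f k) {M s₀ : ℕ} (h : s₀ ≤ M) (N s : ℕ) :
    law f M s₀ N s ≤ 1 := trans_le_one hf _ _ h

theorem law_eq_zero_of_gt (f : ℝ → ℝ) {M s₀ N s : ℕ} (h : s₀ ≤ M) (hN : M ≤ N) (hs : N < s) :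
    law f M s₀ N s = 0 := trans_eq_zero_of_gt f _ (by omega)

theorem law_mul_trans_le (hf : IsRegularUrn f k) {M s₀ N : ℕ} (h : s₀ ≤ M) (hN : M ≤ N)
    (s b s' : ℕ) : law f M s₀ N s * trans f N s b s' ≤ law f M s₀ (N + b) s' := by
  have := mul_trans_le hf (s' := s) (s'' := s') (a := N - M) (b := b) h
  rwa [show M + (N - M) = N by omega, show N - M + b = N + b - M by omega] at this

theorem exists_law_le (hf : IsRegularUrn f k) {M s₀ N : ℕ} (h : s₀ ≤ M) (hN : M ≤ N) (b s' : ℕ) :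
    ∃ s, s ≤ s' ∧ s' ≤ s + b ∧
      law f M s₀ (N + b) s' ≤ (b + 1 : ℝ) * (law f M s₀ N s * trans f N s b s') := by
  obtain ⟨s, h1, h2, h3⟩ := exists_trans_le hf s' (N - M) b h
  rw [show M + (N - M) = N by omega, show N - M + b = N + b - M by omega] at h3
  exact ⟨s, h1, h2, h3⟩

/-! ### A lower bound at interior densities -/

theorem IsRegularUrn.exists_le (hf : IsRegularUrn f k) {κ : ℝ} (hκ : 0 < κ) :
    ∃ e : ℝ, 0 < e ∧ e ≤ 1 ∧ ∀ v, κ ≤ v → κ ≤ 1 - v → e ≤ f v ∧ e ≤ 1 - f v := by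
  have h0 := hf.pos (x := 1 / 2) (by norm_num) (by norm_num)
  have h1 := hf.lt_one (x := 1 / 2) (by norm_num) (by norm_num)
  refine ⟨min 1 (κ ^ k * min (f (1 / 2)) (1 - f (1 / 2))), ?_, min_le_left _ _, fun v hv hv' => ?_⟩
  · exact lt_min one_pos (mul_pos (pow_pos hκ _) (lt_min h0 (by linarith)))
  · have := hf.scale (1 / 2) v κ (by norm_num) (by norm_num) hκ.le (by linarith) (by linarith)
    constructor
    · refine (min_le_right _ _).trans (le_trans ?_ this.1)
      exact mul_le_mul_of_nonneg_left (min_le_left _ _) (by positivity)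
    · refine (min_le_right _ _).trans (le_trans ?_ this.2)
      exact mul_le_mul_of_nonneg_left (min_le_right _ _) (by positivity)

/-- With positive probability both colours are present after at most one step. -/
theorem exists_interior_state (hf : IsRegularUrn f k) {M s₀ : ℕ} (hM : 0 < M) (h : s₀ ≤ M) :
    ∃ M' s', M ≤ M' ∧ 0 < s' ∧ s' < M' ∧ 0 < law f M s₀ M' s' := by
  rcases Nat.eq_zero_or_pos s₀ with rfl | h0
  · refine ⟨M + 1, 1, by omega, by omega, by omega, ?_⟩
    simp [law, trans, hf.zero_pos]
  rcases h.eq_or_lt with rfl | h1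
  · refine ⟨s₀ + 1, s₀, by omega, by omega, by omega, ?_⟩
    have : (s₀ : ℝ) ≠ 0 := by positivity
    simp [law, trans, div_self this, hf.one_lt]
  · exact ⟨M, s₀, le_rfl, h0, h1, by simp [law, trans]⟩

/-- The positive values of a function on a finite set are bounded away from `0`. -/
theorem exists_pos_le (S : Finset ℕ) (g : ℕ → ℝ) :
    ∃ c : ℝ, 0 < c ∧ ∀ s ∈ S, 0 < g s → c ≤ g s := by
  classical
  induction S using Finset.induction_on with
  | empty => exact ⟨1, one_pos, by simp⟩
  | insert a S _ ih =>
    obtain ⟨c, hc, h⟩ := ih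
    by_cases ha : 0 < g a
    · refine ⟨min c (g a), lt_min hc ha, fun s hs hg => ?_⟩
      rcases Finset.mem_insert.1 hs with rfl | hs
      · exact min_le_right _ _
      · exact (min_le_left _ _).trans (h s hs hg)
    · refine ⟨c, hc, fun s hs hg => ?_⟩
      rcases Finset.mem_insert.1 hs with rfl | hs
      · exact absurd hg ha
      · exact h s hs hg

/-- At densities bounded away from `0` and `1` the law of the urn decays at most exponentially:
the urn may follow the straight line from the origin to the state in question. -/
theorem exists_pow_le_law (hf : IsRegularUrn f k) {M s₀ : ℕ} (hM : 0 < M) (h : s₀ ≤ M) {κ : ℝ}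
    (hκ : 0 < κ) : ∃ c : ℝ, 0 < c ∧ c ≤ 1 ∧ ∃ N₀ : ℕ, M ≤ N₀ ∧ ∀ n : ℕ, N₀ ≤ n → ∀ s : ℕ,
      κ * n ≤ s → κ * n ≤ n - s → c ^ n ≤ law f M s₀ n s := by
  obtain ⟨M', s', hMM, hs0, hs1, hpos⟩ := exists_interior_state hf hM h
  obtain ⟨e, he0, he1, he⟩ := hf.exists_le (κ := κ / 2) (by positivity)
  -- From the time `T` on, the line is a possible path and its rounding changes the densities by at
  -- most `κ / 2`.
  obtain ⟨T, hT⟩ := exists_nat_gt (max ((M' : ℝ) / κ + 1 / κ) (2 / κ))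
  have hT1 : (M' : ℝ) + 1 < κ * T := by
    have := (le_max_left _ _).trans_lt hT
    rw [← add_div, div_lt_iff₀ hκ] at this; linarith
  have hT2 : 2 < κ * T := by
    have := (le_max_right _ _).trans_lt hT
    rw [div_lt_iff₀ hκ] at this; linarith
  obtain ⟨c₁, hc₁, hmin⟩ := exists_pos_le (Finset.range (T + 1)) (law f M s₀ T)
  have hTpos : 0 < T := by
    rcases Nat.eq_zero_or_pos T with rfl | h
    · simp at hT2; linarith
    · exact h
  refine ⟨min c₁ e, lt_min hc₁ he0, (min_le_right _ _).trans he1, max T M, le_max_right _ _,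
    fun n hn s hs hs' => ?_⟩
  have hnT : T ≤ n := (le_max_left _ _).trans hn
  have hn0 : 0 < n := by omega
  have hn0' : (0 : ℝ) < n := by exact_mod_cast hn0
  have hκ1 : κ ≤ 1 := by nlinarith
  -- The states on the straight line.
  have hline : ∀ τ : ℕ, κ * τ - 1 ≤ ((s * τ / n : ℕ) : ℝ) ∧
      ((s * τ / n : ℕ) : ℝ) ≤ (1 - κ) * τ := by
    intro τ
    have h1 : ((s * τ / n : ℕ) : ℝ) ≤ (s * τ : ℕ) / (n : ℝ) := Nat.cast_div_le
    have h2 : ((s * τ : ℕ) : ℝ) / (n : ℝ) < (s * τ / n : ℕ) + 1 := by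
      rw [div_lt_iff₀ hn0']
      have h5 := Nat.lt_div_mul_add (a := s * τ) hn0
      have h6 : s * τ < (s * τ / n + 1) * n := by linarith
      exact_mod_cast h6
    have h3 : κ * τ ≤ (s * τ : ℕ) / (n : ℝ) := by
      rw [le_div_iff₀ hn0']; push_cast
      nlinarith [mul_le_mul_of_nonneg_right hs (Nat.cast_nonneg (α := ℝ) τ)]
    have h4 : ((s * τ : ℕ) : ℝ) / n ≤ (1 - κ) * τ := by
      rw [div_le_iff₀ hn0']; push_cast
      nlinarith [mul_le_mul_of_nonneg_right hs' (Nat.cast_nonneg (α := ℝ) τ)]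
    exact ⟨by linarith, by linarith⟩
  have hTM : M' ≤ T := by
    have : (M' : ℝ) ≤ T := by nlinarith
    exact_mod_cast this
  have key : ∀ i, c₁ * e ^ i ≤ law f M s₀ (T + i) (s * (T + i) / n) := by
    intro i
    induction i with
    | zero =>
      obtain ⟨l1, l2⟩ := hline T
      have a1 : s' ≤ s * T / n := by
        have h1 : ((s' + 1 : ℕ) : ℝ) ≤ M' := by exact_mod_cast hs1
        have : (s' : ℝ) ≤ (s * T / n : ℕ) := by push_cast at h1; linarith
        exact_mod_cast this
      have a2 : s * T / n + M' ≤ T := by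
        have : ((s * T / n + M' : ℕ) : ℝ) ≤ T := by push_cast at l2 ⊢; linarith
        exact_mod_cast this
      have hp := trans_pos hf (T - M') (n := M') (s := s') (r := s * T / n - s') hs0 hs1 (by omega)
      have := law_mul_trans_le hf h hMM s' (T - M') (s' + (s * T / n - s'))
      rw [show M' + (T - M') = T by omega, show s' + (s * T / n - s') = s * T / n by omega] at this
      rw [show s' + (s * T / n - s') = s * T / n by omega] at hp
      simp only [pow_zero, mul_one, add_zero]
      exact hmin _ (Finset.mem_range.2 (by omega)) ((mul_pos hpos hp).trans_le this)
    | succ i ih =>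
      obtain ⟨l1, l2⟩ := hline (T + i)
      set m := s * (T + i) / n with hm
      have hTi : (0 : ℝ) < ((T + i : ℕ) : ℝ) := by positivity
      have hle : (T : ℝ) ≤ ((T + i : ℕ) : ℝ) := by push_cast; linarith [Nat.cast_nonneg (α := ℝ) i]
      have hv := he ((m : ℝ) / ((T + i : ℕ) : ℝ))
        (by rw [le_div_iff₀ hTi]; nlinarith)
        (by rw [le_sub_comm, div_le_iff₀ hTi]; nlinarith)
      have hmT : m ≤ T + i := by
        have : (m : ℝ) ≤ ((T + i : ℕ) : ℝ) := by nlinarith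
        exact_mod_cast this
      have hsn : s ≤ n := by
        have : (s : ℝ) ≤ n := by nlinarith
        exact_mod_cast this
      have hnext : s * (T + (i + 1)) / n = m ∨ s * (T + (i + 1)) / n = m + 1 := by
        have h1 : m ≤ s * (T + (i + 1)) / n :=
          Nat.div_le_div_right (Nat.mul_le_mul_left _ (by omega))
        have h2 : s * (T + (i + 1)) / n ≤ m + 1 := by
          rw [hm, ← Nat.add_div_right _ hn0]
          exact Nat.div_le_div_right (by nlinarith)
        omega
      have hstep : e ≤ trans f (T + i) m 1 (s * (T + (i + 1)) / n) := by
        rcases hnext with h' | h' <;> rw [h'] <;> simp only [trans]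
        · simpa using hv.2
        · simpa using hv.1
      have := law_mul_trans_le hf h (show M ≤ T + i by omega) m 1 (s * (T + (i + 1)) / n)
      refine le_trans ?_ this
      rw [pow_succ, ← mul_assoc]
      exact mul_le_mul ih hstep he0.le (law_nonneg hf h _ _)
  have := key (n - T)
  rw [show T + (n - T) = n by omega, Nat.mul_div_cancel _ hn0] at this
  refine le_trans ?_ this
  have hm0 : 0 < min c₁ e := lt_min hc₁ he0
  calc (min c₁ e) ^ n ≤ (min c₁ e) ^ (n - T + 1) :=
        pow_le_pow_of_le_one hm0.le ((min_le_right _ _).trans he1) (by omega)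
    _ = min c₁ e * (min c₁ e) ^ (n - T) := pow_succ' _ _
    _ ≤ c₁ * e ^ (n - T) := mul_le_mul (min_le_left _ _)
        (pow_le_pow_left₀ hm0.le (min_le_right _ _) _) (by positivity) hc₁.le

/-! ### Comparison of the urn with a magnified copy of itself -/

/-- The arithmetic of `magnified_density`, for one of the two colours. -/
theorem mul_div_le_of_slack {e a t l q : ℝ} (he : 0 ≤ e) (ha : a ≤ t) (hl : 0 ≤ l) (ht : 0 < t)
    (hlt : l ≤ t) (hq : 3 * (e + 1) * l ≤ q) :
    e / (e + 1) * ((a + l) / t) ≤ (e * a + q) / ((e + 1) * (t + l)) := by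
  rw [div_mul_div_comm, div_le_div_iff₀ (by positivity) (by positivity)]
  have h1 : e * (a + l) * (t + l) ≤ (e * a + q) * t := by
    have h2 : e * (a * l) ≤ e * (t * l) := by gcongr
    have h3 : e * (l * l) ≤ e * (t * l) := by gcongr
    have h4 : 3 * (e + 1) * l * t ≤ q * t := by gcongr
    have h5 : 0 ≤ l * t := by positivity
    linarith
  calc e * (a + l) * ((e + 1) * (t + l)) = (e + 1) * (e * (a + l) * (t + l)) := by ring
    _ ≤ (e + 1) * ((e * a + q) * t) := by gcongr
    _ = _ := by ring

/-- A density `u` reached within `l` steps from `s` black balls among `t`, compared with a density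
`v` reached within `(e + 1) * j * l` steps in the copy magnified by `(e + 1) * j`. For each `j` the
copy superposes `e` paths with `s` black balls among `t` and one path with `q` of them. The
proportion of the latter keeps `v` away from `0` and `1` and outweighs the variation of the
densities along the path, which is of order `l / t`. -/
theorem magnified_density {e j t l s q i₁ j₁ i₂ j₂ : ℕ} (hj : 0 < j) (hs : s ≤ t)
    (hlt : l ≤ t) (ht : 0 < t) (hq : 3 * (e + 1) * l ≤ q) (hq' : q + 3 * (e + 1) * l ≤ t)
    (hij₁ : i₁ ≤ j₁) (hj₁ : j₁ < l) (hij₂ : i₂ ≤ j₂) (hj₂ : j₂ < (e + 1) * j * l) :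
    ((e : ℝ) * s + q) / ((e + 1) * (t + l)) ≤
      ((j * (e * s + q) + i₂ : ℕ) : ℝ) / (((e + 1) * j * t + j₂ : ℕ) : ℝ) ∧
    ((e : ℝ) * (t - s) + (t - q)) / ((e + 1) * (t + l)) ≤
      1 - ((j * (e * s + q) + i₂ : ℕ) : ℝ) / (((e + 1) * j * t + j₂ : ℕ) : ℝ) ∧
    (e : ℝ) / (e + 1) * (((s + i₁ : ℕ) : ℝ) / ((t + j₁ : ℕ) : ℝ)) ≤
      ((e : ℝ) * s + q) / ((e + 1) * (t + l)) ∧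
    (e : ℝ) / (e + 1) * (1 - ((s + i₁ : ℕ) : ℝ) / ((t + j₁ : ℕ) : ℝ)) ≤
      ((e : ℝ) * (t - s) + (t - q)) / ((e + 1) * (t + l)) := by
  have hj' : (0 : ℝ) < j := by exact_mod_cast hj
  have ht' : (0 : ℝ) < t := by exact_mod_cast ht
  have hs' : (s : ℝ) ≤ t := by exact_mod_cast hs
  have hlt' : (l : ℝ) ≤ t := by exact_mod_cast hlt
  have hqt : (q : ℝ) ≤ t := by exact_mod_cast (by omega : q ≤ t)
  have h1 : (i₁ : ℝ) ≤ j₁ := by exact_mod_cast hij₁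
  have h2 : (j₁ : ℝ) ≤ l := by exact_mod_cast hj₁.le
  have h3 : (i₂ : ℝ) ≤ j₂ := by exact_mod_cast hij₂
  have h4 : (j₂ : ℝ) ≤ (e + 1) * j * l := by exact_mod_cast hj₂.le
  have hq1 : (3 : ℝ) * (e + 1) * l ≤ q := by exact_mod_cast hq
  have hq2 : (q : ℝ) + 3 * (e + 1) * l ≤ t := by exact_mod_cast hq'
  have hi₁ : (0 : ℝ) ≤ i₁ := by positivity
  have hi₂ : (0 : ℝ) ≤ i₂ := by positivity
  have hj₁0 : (0 : ℝ) ≤ j₁ := by positivity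
  have hj₂0 : (0 : ℝ) ≤ j₂ := by positivity
  have hl0 : (0 : ℝ) ≤ l := by positivity
  have he0 : (0 : ℝ) ≤ e := by positivity
  have hd : ((e : ℝ) + 1) * j * t + j₂ ≤ j * ((e + 1) * (t + l)) := by linarith
  push_cast
  refine ⟨?_, ?_, ?_, ?_⟩
  · rw [← mul_div_mul_left _ _ hj'.ne']
    gcongr
    linarith
  · rw [← mul_div_mul_left _ _ hj'.ne', one_sub_div (by positivity)]
    have : 0 ≤ (e : ℝ) * (t - s) + (t - q) := by
      have : 0 ≤ (e : ℝ) * (t - s) := mul_nonneg he0 (by linarith)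
      linarith
    have h5 : (j : ℝ) * (e * (t - s) + (t - q)) ≤
        (e + 1) * j * t + j₂ - (j * (e * s + q) + i₂) := by linarith
    exact div_le_div₀ (by linarith [mul_nonneg hj'.le this]) h5 (by positivity) hd
  · refine le_trans ?_ (mul_div_le_of_slack he0 hs' hl0 ht' hlt' hq1)
    gcongr <;> linarith
  · refine le_trans ?_ (mul_div_le_of_slack (a := (t : ℝ) - s) he0
      (by linarith [Nat.cast_nonneg (α := ℝ) s]) hl0 ht' hlt' (by linarith))
    rw [one_sub_div (by positivity)]
    gcongr <;> linarith

/-- The power `j * l` of this number is lost when `l` steps of the urn are magnified by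
`(e + 1) * j`. On the parts that copy the original path the probability of either colour drops at
most by the factor `(e / (e + 1)) ^ k`; on the part that follows the line of slope `y` it is at
least the second factor. For large `e` the loss per step, a root of order `e + 1`, tends to `1`. -/
noncomputable def magnifyLoss (f : ℝ → ℝ) (k : ℕ) (y : ℝ) (e : ℕ) : ℝ :=
  (((e : ℝ) / (e + 1)) ^ k) ^ e * ((1 / (2 * ((e : ℝ) + 1))) ^ k * min (f y) (1 - f y))

theorem min_pos (hf : IsRegularUrn f k) {y : ℝ} (h0 : 0 < y) (h1 : y < 1) :
    0 < min (f y) (1 - f y) :=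
  lt_min (hf.pos h0.le h1) (sub_pos.2 (hf.lt_one h0 h1.le))

/-- A transition of the urn is reproduced by its magnified copy with almost the corresponding power
of its probability. The number of paths causes no loss, since
`choose l r ^ m ≤ choose (m * l) (m * r)`. -/
theorem trans_pow_le_trans_magnified (hf : IsRegularUrn f k) {y : ℝ} (h0 : 0 < y) (h1 : y < 1)
    (e l : ℕ) (hl : 0 < l) :
    ∃ T : ℕ, l ≤ T ∧ ∀ t ≥ T, ∀ j > 0, ∀ s s', s ≤ t → s ≤ s' → s' ≤ s + l →
      (trans f t s l s') ^ (e * j) * magnifyLoss f k y e ^ (j * l) ≤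
        trans f ((e + 1) * j * t) (j * (e * s + ⌊y * t⌋₊)) ((e + 1) * j * l)
          (j * (e * s' + ⌊y * (t + l : ℕ)⌋₊)) := by
  obtain ⟨T₀, hT₀⟩ := exists_nat_gt (max ((3 * (e + 1) * l + l + 2) / y)
    ((3 * (e + 1) * l + l + 2) / (1 - y)))
  refine ⟨max T₀ (l + 1), by omega, fun t ht j hj s s' hst hss' hs'l => ?_⟩
  have htl : l + 1 ≤ t := (le_max_right _ _).trans ht
  have htT : T₀ ≤ t := (le_max_left _ _).trans ht
  have htT' : (T₀ : ℝ) ≤ t := by exact_mod_cast htT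
  have ht0 : (0 : ℝ) < t := by exact_mod_cast (by omega : 0 < t)
  have hy1 : 0 < 1 - y := by linarith
  have hl0 : (0 : ℝ) ≤ l := by positivity
  have b1 : (3 * (e + 1) * l + l + 2 : ℝ) < y * t := by
    have := ((le_max_left _ _).trans_lt hT₀).trans_le htT'
    rwa [div_lt_iff₀' h0] at this
  have b2 : (3 * (e + 1) * l + l + 2 : ℝ) < (1 - y) * t := by
    have := ((le_max_right _ _).trans_lt hT₀).trans_le htT'
    rwa [div_lt_iff₀' hy1] at this
  set q := ⌊y * t⌋₊ with hq
  have hq_le : (q : ℝ) ≤ y * t := Nat.floor_le (by positivity)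
  have hq_gt : y * t < q + 1 := Nat.lt_floor_add_one _
  have hq1 : 3 * (e + 1) * l ≤ q := by
    have : (3 * (e + 1) * l : ℝ) ≤ q := by linarith
    exact_mod_cast this
  have hq2 : q + 3 * (e + 1) * l ≤ t := by
    have : (q + 3 * (e + 1) * l : ℝ) ≤ t := by linarith
    exact_mod_cast this
  obtain ⟨g, hg, hgl⟩ : ∃ g, ⌊y * (t + l : ℕ)⌋₊ = q + g ∧ g ≤ l := by
    have a1 : q ≤ ⌊y * (t + l : ℕ)⌋₊ := Nat.floor_le_floor (by gcongr; omega)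
    have a2 : ⌊y * (t + l : ℕ)⌋₊ ≤ q + l := by
      rw [hq, ← Nat.floor_add_natCast (by positivity)]
      refine Nat.floor_le_floor ?_
      push_cast
      nlinarith
    exact ⟨_, (Nat.add_sub_cancel' a1).symm, by omega⟩
  obtain ⟨r, rfl⟩ := Nat.exists_eq_add_of_le hss'
  have hrl : r ≤ l := by omega
  -- The extreme values of the urn function along the paths of the original urn.
  set S := (Finset.range l ×ˢ Finset.range l).filter (fun x => x.2 ≤ x.1) with hS
  set D : ℕ × ℕ → ℝ := fun x => ((s + x.2 : ℕ) : ℝ) / ((t + x.1 : ℕ) : ℝ) with hD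
  have hSne : S.Nonempty := ⟨(0, 0), by simp [hS, hl]⟩
  obtain ⟨u₁, hu₁, hmax⟩ := Finset.exists_max_image S (fun x => f (D x)) hSne
  obtain ⟨u₂, hu₂, hmin⟩ := Finset.exists_min_image S (fun x => f (D x)) hSne
  have hmem : ∀ x ∈ S, x.2 ≤ x.1 ∧ x.1 < l := fun x hx => by
    simp only [hS, Finset.mem_filter, Finset.mem_product, Finset.mem_range] at hx
    omega
  have hDu : ∀ x ∈ S, 0 ≤ D x ∧ D x ≤ 1 := fun x hx => by
    have := hmem x hx
    exact div_mem_unit (by omega)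
  have hA0 : 0 ≤ f (D u₁) := hf.nonneg _ (hDu _ hu₁).1 (hDu _ hu₁).2
  have hB0 : 0 ≤ 1 - f (D u₂) := sub_nonneg.2 (hf.le_one _ (hDu _ hu₂).1 (hDu _ hu₂).2)
  have hupper := trans_le_choose_mul hf (n := t) (s := s) hA0 hB0 l r hst
    (fun a ha b hb => by
      have hx : (a, b) ∈ S := by simp [hS]; omega
      have e1 := hmax _ hx
      have e2 := hmin _ hx
      simp only [hD] at e1 e2 ⊢
      exact ⟨e1, by linarith⟩)
  -- Lower bounds for the magnified urn.
  set lam : ℝ := (e : ℝ) / (e + 1) with hlam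
  have hlam0 : 0 ≤ lam := by positivity
  set κ : ℝ := (1 / (2 * ((e : ℝ) + 1))) ^ k * min (f y) (1 - f y) with hκ
  have hκ0 : 0 < κ := mul_pos (by positivity) (min_pos hf h0 h1)
  have hst' : (s : ℝ) ≤ t := by exact_mod_cast hst
  have hyl : y * l ≤ l := mul_le_of_le_one_left hl0 h1.le
  have hyl' : 0 ≤ y * l := by positivity
  have hel : (0 : ℝ) ≤ 3 * (e + 1) * l := by positivity
  have hv1 : y * (t + l) ≤ 2 * (e * s + q) := by
    have : 0 ≤ (e : ℝ) * s := by positivity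
    linarith
  have hv2 : (1 - y) * (t + l) ≤ 2 * (e * (t - s) + (t - q)) := by
    have : 0 ≤ (e : ℝ) * (t - s) := mul_nonneg (by positivity) (by linarith)
    linarith
  have hlow : ∀ j₂ < (e + 1) * j * l, ∀ i₂ ≤ j₂,
      max (lam ^ k * f (D u₁)) κ ≤
        f (((j * (e * s + q) + i₂ : ℕ) : ℝ) / (((e + 1) * j * t + j₂ : ℕ) : ℝ)) ∧
      max (lam ^ k * (1 - f (D u₂))) κ ≤
        1 - f (((j * (e * s + q) + i₂ : ℕ) : ℝ) / (((e + 1) * j * t + j₂ : ℕ) : ℝ)) := by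
    intro j₂ hj₂ i₂ hi₂
    set v := ((j * (e * s + q) + i₂ : ℕ) : ℝ) / (((e + 1) * j * t + j₂ : ℕ) : ℝ) with hv
    have m1 := hmem _ hu₁
    have m2 := hmem _ hu₂
    obtain ⟨d1, d2, d3, d4⟩ := magnified_density (i₁ := u₁.2) (j₁ := u₁.1) (i₂ := i₂) (j₂ := j₂)
      (l := l) hj hst (by omega) (by omega) hq1 hq2 m1.1 m1.2 hi₂ hj₂
    obtain ⟨-, -, d5, d6⟩ := magnified_density (i₁ := u₂.2) (j₁ := u₂.1) (i₂ := i₂) (j₂ := j₂)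
      (l := l) hj hst (by omega) (by omega) hq1 hq2 m2.1 m2.2 hi₂ hj₂
    have s1 := (hf.scale (D u₁) v lam (hDu _ hu₁).1 (hDu _ hu₁).2 hlam0 (d3.trans d1)
      (d4.trans d2)).1
    have s2 := (hf.scale (D u₂) v lam (hDu _ hu₂).1 (hDu _ hu₂).2 hlam0 (d5.trans d1)
      (d6.trans d2)).2
    have s3 := hf.scale y v (1 / (2 * ((e : ℝ) + 1))) h0.le h1.le (by positivity)
      (by
        refine le_trans ?_ d1
        rw [div_mul_eq_mul_div, div_le_div_iff₀ (by positivity) (by positivity)]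
        calc 1 * y * ((e + 1) * (t + l)) = (e + 1) * (y * (t + l)) := by ring
          _ ≤ (e + 1) * (2 * (e * s + q)) := mul_le_mul_of_nonneg_left hv1 (by positivity)
          _ = _ := by ring)
      (by
        refine le_trans ?_ d2
        rw [div_mul_eq_mul_div, div_le_div_iff₀ (by positivity) (by positivity)]
        calc 1 * (1 - y) * ((e + 1) * (t + l)) = (e + 1) * ((1 - y) * (t + l)) := by ring
          _ ≤ (e + 1) * (2 * (e * (t - s) + (t - q))) :=
            mul_le_mul_of_nonneg_left hv2 (by positivity)
          _ = _ := by ring)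
    have hp : (0 : ℝ) ≤ (1 / (2 * ((e : ℝ) + 1))) ^ k := by positivity
    exact ⟨max_le s1 ((mul_le_mul_of_nonneg_left (min_le_left _ _) hp).trans s3.1),
      max_le s2 ((mul_le_mul_of_nonneg_left (min_le_right _ _) hp).trans s3.2)⟩
  have hstart : j * (e * s + q) ≤ (e + 1) * j * t := by
    have : e * s + q ≤ (e + 1) * t := by
      have : e * s ≤ e * t := Nat.mul_le_mul_left _ hst
      rw [add_mul]; omega
    calc j * (e * s + q) ≤ j * ((e + 1) * t) := Nat.mul_le_mul_left _ this
      _ = _ := by ring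
  have hlower := choose_mul_le_trans hf (n := (e + 1) * j * t) (s := j * (e * s + q))
    (le_max_of_le_right hκ0.le) (le_max_of_le_right hκ0.le) ((e + 1) * j * l)
    (j * (e * r + g)) hstart hlow
  rw [hg, show j * (e * (s + r) + (q + g)) = j * (e * s + q) + j * (e * r + g) by ring]
  refine le_trans ?_ hlower
  obtain ⟨w, rfl⟩ := Nat.exists_eq_add_of_le hrl
  obtain ⟨z, hz⟩ := Nat.exists_eq_add_of_le hgl
  have hexp : (e + 1) * j * (r + w) - j * (e * r + g) = (e * j) * w + j * z := by
    have h5 : j * (r + w) = j * (g + z) := by rw [hz]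
    have h6 : (e + 1) * j * (r + w) = (e * j) * w + j * z + j * (e * r + g) := by linarith
    rw [h6, Nat.add_sub_cancel]
  have hchoose : (((r + w).choose r : ℝ)) ^ (e * j) ≤
      ((((e + 1) * j * (r + w)).choose (j * (e * r + g)) : ℕ) : ℝ) := by
    have c1 := choose_pow_le (r + w) r (e * j)
    have c2 := choose_mul_choose_le (e * j * (r + w)) (e * j * r) (j * (r + w)) (j * g)
    have c3 : 1 ≤ (j * (r + w)).choose (j * g) :=
      Nat.choose_pos (Nat.mul_le_mul_left _ hgl)
    have c4 : (r + w).choose r ^ (e * j) ≤ ((e + 1) * j * (r + w)).choose (j * (e * r + g)) := by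
      calc _ ≤ (e * j * (r + w)).choose (e * j * r) * 1 := by simpa using c1
        _ ≤ _ := Nat.mul_le_mul_left _ c3
        _ ≤ _ := c2
        _ = _ := by congr 1 <;> ring
    exact_mod_cast c4
  rw [Nat.add_sub_cancel_left] at hupper
  have hlk : 0 ≤ lam ^ k := by positivity
  calc trans f t s (r + w) (s + r) ^ (e * j) * magnifyLoss f k y e ^ (j * (r + w))
      ≤ (((r + w).choose r : ℝ) * f (D u₁) ^ r * (1 - f (D u₂)) ^ w) ^ (e * j) *
          magnifyLoss f k y e ^ (j * (r + w)) := by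
        have : 0 ≤ magnifyLoss f k y e := by
          rw [magnifyLoss]; exact mul_nonneg (by positivity) hκ0.le
        exact mul_le_mul_of_nonneg_right
          (pow_le_pow_left₀ (trans_nonneg hf _ _ hst) hupper _) (by positivity)
    _ = ((r + w).choose r : ℝ) ^ (e * j) *
          ((lam ^ k * f (D u₁)) ^ (e * j * r) * κ ^ (j * g)) *
          ((lam ^ k * (1 - f (D u₂))) ^ (e * j * w) * κ ^ (j * z)) := by
        rw [magnifyLoss, ← hlam, ← hκ]
        have e1 : κ ^ (j * (r + w)) = κ ^ (j * g) * κ ^ (j * z) := by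
          rw [hz, ← pow_add, mul_add]
        rw [mul_pow _ κ, e1]
        simp only [mul_pow]
        ring
    _ ≤ ((r + w).choose r : ℝ) ^ (e * j) *
          ((max (lam ^ k * f (D u₁)) κ) ^ (e * j * r) * (max (lam ^ k * f (D u₁)) κ) ^ (j * g)) *
          ((max (lam ^ k * (1 - f (D u₂))) κ) ^ (e * j * w) *
            (max (lam ^ k * (1 - f (D u₂))) κ) ^ (j * z)) := by
        gcongr
        · exact le_max_left _ _
        · exact le_max_right _ _
        · exact le_max_left _ _
        · exact le_max_right _ _
    _ = ((r + w).choose r : ℝ) ^ (e * j) * (max (lam ^ k * f (D u₁)) κ) ^ (j * (e * r + g)) *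
          (max (lam ^ k * (1 - f (D u₂))) κ) ^ ((e + 1) * j * (r + w) - j * (e * r + g)) := by
        rw [hexp, ← pow_add, ← pow_add, show e * j * r + j * g = j * (e * r + g) by ring]
    _ ≤ _ := by
        gcongr

theorem magnifyLoss_pos (hf : IsRegularUrn f k) {y : ℝ} (h0 : 0 < y) (h1 : y < 1) {e : ℕ}
    (he : 0 < e) : 0 < magnifyLoss f k y e := by
  have := min_pos hf h0 h1
  have : (0 : ℝ) < e := by exact_mod_cast he
  unfold magnifyLoss
  positivity

theorem magnifyLoss_le_one (hf : IsRegularUrn f k) {y : ℝ} (h0 : 0 < y) (h1 : y < 1) (e : ℕ) :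
    magnifyLoss f k y e ≤ 1 := by
  have hm := min_pos hf h0 h1
  have hm1 : min (f y) (1 - f y) ≤ 1 := (min_le_left _ _).trans (hf.le_one _ h0.le h1.le)
  have a1 : (e : ℝ) / (e + 1) ≤ 1 := div_le_one_of_le₀ (by linarith) (by positivity)
  have a2 : 1 / (2 * ((e : ℝ) + 1)) ≤ 1 :=
    div_le_one_of_le₀ (by linarith [Nat.cast_nonneg (α := ℝ) e]) (by positivity)
  exact mul_le_one₀ (pow_le_one₀ (by positivity) (pow_le_one₀ (by positivity) a1)) (by positivity)
    (mul_le_one₀ (pow_le_one₀ (by positivity) a2) hm.le hm1)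

theorem exists_law_pos (hf : IsRegularUrn f k) {y : ℝ} (h0 : 0 < y) (h1 : y < 1) {M s₀ : ℕ}
    (hM : 0 < M) (h : s₀ ≤ M) : ∃ c : ℝ, 0 < c ∧ c ≤ 1 ∧ ∃ N₀ : ℕ, M ≤ N₀ ∧ ∀ N ≥ N₀,
      c ^ N ≤ law f M s₀ N ⌊y * N⌋₊ := by
  have hκ : 0 < min (y / 2) (1 - y) := lt_min (by linarith) (by linarith)
  obtain ⟨c, hc, hc1, N₀, hMN, hN⟩ := exists_pow_le_law hf hM h hκ
  obtain ⟨N₁, hN₁⟩ := exists_nat_gt (2 / y)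
  refine ⟨c, hc, hc1, max N₀ N₁, hMN.trans (le_max_left _ _), fun N hN' => ?_⟩
  have a1 : (N₁ : ℝ) ≤ N := by exact_mod_cast (le_max_right _ _).trans hN'
  have a2 : 2 < y * N := by
    rw [div_lt_iff₀' h0] at hN₁; nlinarith
  have a3 : y * N < ⌊y * N⌋₊ + 1 := Nat.lt_floor_add_one _
  have a4 : (⌊y * N⌋₊ : ℝ) ≤ y * N := Nat.floor_le (by positivity)
  have hN0 : (0 : ℝ) ≤ N := Nat.cast_nonneg _
  refine hN N ((le_max_left _ _).trans hN') _ ?_ ?_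
  · have := mul_le_mul_of_nonneg_right (min_le_left (y / 2) (1 - y)) hN0
    linarith
  · have := mul_le_mul_of_nonneg_right (min_le_right (y / 2) (1 - y)) hN0
    linarith

/-- The law of the urn at the time `N` bounds from below the law of another urn with the same urn
function at any large multiple of `N`. -/
theorem law_pow_le_law_magnified (hf : IsRegularUrn f k) {y : ℝ} (h0 : 0 < y) (h1 : y < 1)
    {M s₀ M₁ s₁ : ℕ} (h : s₀ ≤ M) (hM₁ : 0 < M₁) (h₁ : s₁ ≤ M₁) {e l : ℕ} (he : 0 < e)
    (hl : 0 < l) :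
    ∃ (T J : ℕ) (c : ℝ), 0 < c ∧ c ≤ 1 ∧ M ≤ T ∧ 0 < J ∧ ∀ N ≥ T, ∀ j ≥ J,
      M₁ ≤ (e + 1) * j * N ∧
      (law f M s₀ N ⌊y * N⌋₊ ^ e * c ^ ((e + 1) * (T + l)) *
        (magnifyLoss f k y e ^ l / (l + 1 : ℝ) ^ e) ^ (N / l)) ^ j ≤
      law f M₁ s₁ ((e + 1) * j * N) ((e + 1) * j * ⌊y * N⌋₊) := by
  obtain ⟨T₀, hlT, hT₀⟩ := trans_pow_le_trans_magnified hf h0 h1 e l hl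
  obtain ⟨T₁, hT₁⟩ := exists_nat_gt (2 / y)
  have he' : (0 : ℝ) < e := by exact_mod_cast he
  -- The densities in the magnified copy at the initial time are at least this far from `0`, `1`,
  -- whatever the state of the original urn.
  have hκ : 0 < min y (1 - y) / (2 * (e + 1)) :=
    div_pos (lt_min h0 (by linarith)) (by positivity)
  obtain ⟨c, hc0, hc1, J, hMJ, hJ⟩ := exists_pow_le_law hf hM₁ h₁ hκ
  set T := max (max T₀ T₁) (M + 1) with hT
  have hTT₀ : T₀ ≤ T := (le_max_left _ _).trans (le_max_left _ _)
  have hTT₁ : T₁ ≤ T := (le_max_right _ _).trans (le_max_left _ _)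
  have hTM : M + 1 ≤ T := le_max_right _ _
  have hΛ := magnifyLoss_pos hf h0 h1 he
  have hΛ1 := magnifyLoss_le_one hf h0 h1 e
  set G : ℝ := magnifyLoss f k y e ^ l / (l + 1 : ℝ) ^ e with hG
  have hG0 : 0 < G := by positivity
  have hG1 : G ≤ 1 := by
    refine div_le_one_of_le₀ ((pow_le_one₀ hΛ.le hΛ1).trans (one_le_pow₀ ?_)) (by positivity)
    linarith [Nat.cast_nonneg (α := ℝ) l]
  have hJpos : 0 < J := hM₁.trans_le hMJ
  have hbig : ∀ t ≥ T, ∀ j ≥ J, J ≤ (e + 1) * j * t := fun t ht j hj => by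
    have : 1 * j * 1 ≤ (e + 1) * j * t := by gcongr <;> omega
    omega
  refine ⟨T, J, c, hc0, hc1, by omega, hJpos, fun N hN j hj => ⟨hMJ.trans (hbig N hN j hj), ?_⟩⟩
  -- Induction in steps of length `l`, from a bounded time `t₀`. Each step selects the most likely
  -- of the `l + 1` possible predecessors, at the cost of the denominator of `G`.
  have hind : ∀ t₀, T ≤ t₀ → ∀ K s : ℕ,
      law f M s₀ (t₀ + K * l) s ^ (e * j) * (c ^ ((e + 1) * t₀) * G ^ K) ^ j ≤
      law f M₁ s₁ ((e + 1) * j * (t₀ + K * l)) (j * (e * s + ⌊y * (t₀ + K * l : ℕ)⌋₊)) := by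
    intro t₀ ht₀ K
    have hej : e * j ≠ 0 := Nat.mul_ne_zero he.ne' (by omega)
    induction K with
    | zero =>
      intro s
      simp only [zero_mul, add_zero, pow_zero, mul_one]
      rcases Nat.lt_or_ge t₀ s with hs | hs
      · rw [law_eq_zero_of_gt f h (by omega) hs, zero_pow hej, zero_mul]
        exact law_nonneg hf h₁ _ _
      have b1 : law f M s₀ t₀ s ^ (e * j) ≤ 1 :=
        pow_le_one₀ (law_nonneg hf h _ _) (law_le_one hf h _ _)
      have b2 : (c ^ ((e + 1) * t₀)) ^ j = c ^ ((e + 1) * j * t₀) := by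
        rw [← pow_mul]; congr 1; ring
      rw [b2]
      refine (mul_le_of_le_one_left (by positivity) b1).trans
        (hJ _ (hbig t₀ ht₀ j hj) _ ?_ ?_)
      all_goals
        have a0 : (T₁ : ℝ) ≤ t₀ := by exact_mod_cast hTT₁.trans ht₀
        have a1 : 2 < y * t₀ := by rw [div_lt_iff₀' h0] at hT₁; nlinarith
        have a2 : y * t₀ < ⌊y * t₀⌋₊ + 1 := Nat.lt_floor_add_one _
        have a3 : (⌊y * t₀⌋₊ : ℝ) ≤ y * t₀ := Nat.floor_le (by positivity)
        have hs' : (s : ℝ) ≤ t₀ := by exact_mod_cast hs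
        have a4 : min y (1 - y) / (2 * ((e : ℝ) + 1)) * (((e + 1) * j * t₀ : ℕ) : ℝ) =
            j * (min y (1 - y) * t₀ / 2) := by push_cast; field_simp
        have hj0 : (0 : ℝ) ≤ j := by positivity
        have ht0 : (0 : ℝ) ≤ t₀ := by positivity
        rw [a4]
        push_cast
      · have a5 : min y (1 - y) * t₀ ≤ y * t₀ := by gcongr; exact min_le_left _ _
        have : 0 ≤ (e : ℝ) * s := by positivity
        gcongr
        linarith
      · have a5 : min y (1 - y) * t₀ ≤ (1 - y) * t₀ := by gcongr; exact min_le_right _ _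
        have a6 : (e : ℝ) * s ≤ e * t₀ := by gcongr
        have a7 : 0 ≤ (1 - y) * t₀ := mul_nonneg (by linarith) ht0
        have : (j : ℝ) * (min y (1 - y) * t₀ / 2) ≤
            j * ((e + 1) * t₀ - (e * s + ⌊y * t₀⌋₊)) := by
          gcongr
          linarith
        linarith
    | succ K ih =>
      intro s'
      set t := t₀ + K * l with ht
      rw [show t₀ + (K + 1) * l = t + l by rw [ht]; ring]
      have htT : T ≤ t := ht₀.trans (Nat.le_add_right _ _)
      obtain ⟨s, hs1, hs2, hs3⟩ := exists_law_le hf h (show M ≤ t by omega) l s'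
      rcases Nat.lt_or_ge t s with hs | hs
      · rw [law_eq_zero_of_gt f h (by omega) hs, zero_mul, mul_zero] at hs3
        rw [le_antisymm hs3 (law_nonneg hf h _ _), zero_pow hej, zero_mul]
        exact law_nonneg hf h₁ _ _
      have hstep := hT₀ t (hTT₀.trans htT) j (by omega) s s' hs hs1 hs2
      have hCK := law_mul_trans_le hf h₁ (hMJ.trans (hbig t htT j hj)) (j * (e * s + ⌊y * t⌋₊))
        ((e + 1) * j * l) (j * (e * s' + ⌊y * (t + l : ℕ)⌋₊))
      rw [← mul_add] at hCK
      refine le_trans ?_ hCK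
      refine le_trans ?_ (mul_le_mul (ih s) hstep
        (mul_nonneg (pow_nonneg (trans_nonneg hf _ _ hs) _) (pow_nonneg hΛ.le _))
        (law_nonneg hf h₁ _ _))
      have hpow := pow_le_pow_left₀ (law_nonneg hf h _ _) hs3 (e * j)
      calc law f M s₀ (t + l) s' ^ (e * j) * (c ^ ((e + 1) * t₀) * G ^ (K + 1)) ^ j
          ≤ ((l + 1 : ℝ) * (law f M s₀ t s * trans f t s l s')) ^ (e * j) *
              (c ^ ((e + 1) * t₀) * G ^ (K + 1)) ^ j := by gcongr
        _ = law f M s₀ t s ^ (e * j) * (c ^ ((e + 1) * t₀) * G ^ K) ^ j *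
              (trans f t s l s' ^ (e * j) * (G * (l + 1 : ℝ) ^ e) ^ j) := by
            simp only [mul_pow, pow_succ, pow_mul]; ring
        _ = _ := by
            rw [hG, div_mul_cancel₀ _ (by positivity), ← pow_mul, mul_comm l j]
  have hfin := hind (T + (N - T) % l) (by omega) ((N - T) / l) ⌊y * N⌋₊
  have hN' : T + (N - T) % l + (N - T) / l * l = N := by
    have := Nat.mod_add_div (N - T) l
    rw [mul_comm] at this
    omega
  rw [hN', show j * (e * ⌊y * N⌋₊ + ⌊y * N⌋₊) = (e + 1) * j * ⌊y * N⌋₊ by ring] at hfin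
  refine le_trans ?_ hfin
  rw [mul_assoc, mul_pow, ← pow_mul]
  have hmod := Nat.mod_lt (N - T) hl
  have g1 : c ^ ((e + 1) * (T + l)) ≤ c ^ ((e + 1) * (T + (N - T) % l)) :=
    pow_le_pow_of_le_one hc0.le hc1 (Nat.mul_le_mul_left _ (by omega))
  have g2 : G ^ (N / l) ≤ G ^ ((N - T) / l) :=
    pow_le_pow_of_le_one hG0.le hG1 (Nat.div_le_div_right (by omega))
  have : 0 ≤ law f M s₀ N ⌊y * N⌋₊ ^ (e * j) := pow_nonneg (law_nonneg hf h _ _) _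
  gcongr

/-- The urn joins two nearby states with interior densities at an exponential cost in the time. -/
theorem exists_pow_le_trans (hf : IsRegularUrn f k) {κ : ℝ} (hκ : 0 < κ) :
    ∃ e : ℝ, 0 < e ∧ e ≤ 1 ∧ ∀ n s b r : ℕ, 0 < n → s ≤ n → r ≤ b →
      κ * (n + b : ℕ) ≤ s → κ * (n + b : ℕ) ≤ n - s → e ^ b ≤ trans f n s b (s + r) := by
  obtain ⟨e, he0, he1, he⟩ := hf.exists_le hκ
  refine ⟨e, he0, he1, fun n s b r hn hs hr hl hu => ?_⟩
  have := choose_mul_le_trans hf (n := n) (s := s) he0.le he0.le b r hs (fun j hj i hi => by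
    have hn' : (0 : ℝ) < ((n + j : ℕ) : ℝ) := by positivity
    have h1 : ((n + j : ℕ) : ℝ) ≤ (n + b : ℕ) := by exact_mod_cast (by omega)
    have h2 : (i : ℝ) ≤ j := by exact_mod_cast hi
    have h3 := mul_le_mul_of_nonneg_left h1 hκ.le
    refine he _ ?_ ?_
    · rw [le_div_iff₀ hn']; push_cast at *; linarith [Nat.cast_nonneg (α := ℝ) i]
    · rw [le_sub_comm, div_le_iff₀ hn']; push_cast at *; linarith)
  refine le_trans ?_ this
  rw [mul_assoc, ← pow_add, show r + (b - r) = b by omega]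
  have : (1 : ℝ) ≤ b.choose r := by exact_mod_cast Nat.choose_pos hr
  exact le_mul_of_one_le_left (by positivity) this

/-! ### Existence of the entropy density at interior points -/

theorem eventually_log_le {c : ℝ} (hc : 0 < c) : ∀ᶠ x : ℝ in atTop, Real.log x ≤ c * x := by
  filter_upwards [Real.isLittleO_log_id_atTop.bound hc, eventually_ge_atTop 0] with x hx hx0
  simp only [id, Real.norm_eq_abs, abs_of_nonneg hx0] at hx
  exact (le_abs_self _).trans hx

theorem exists_neg_log_magnifyLoss_le (hf : IsRegularUrn f k) {y : ℝ} (h0 : 0 < y) (h1 : y < 1)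
    {η : ℝ} (hη : 0 < η) : ∃ e : ℕ, 0 < e ∧ -Real.log (magnifyLoss f k y e) ≤ (e + 1) * η := by
  have hm := min_pos hf h0 h1
  set m := min (f y) (1 - f y) with hmdef
  have hT : Tendsto (fun e : ℕ => 2 * ((e : ℝ) + 1)) atTop atTop :=
    (tendsto_atTop_add_const_right _ _ tendsto_natCast_atTop_atTop).const_mul_atTop two_pos
  have ev1 := hT.eventually (eventually_log_le (c := η / (4 * (k + 1))) (by positivity))
  have ev2 := hT.eventually (eventually_ge_atTop (4 * (k - Real.log m) / η))
  obtain ⟨e, he1, he2, he⟩ := (ev1.and (ev2.and (eventually_gt_atTop 0))).exists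
  refine ⟨e, he, ?_⟩
  have he' : (0 : ℝ) < e := by exact_mod_cast he
  have b0 : -Real.log ((e : ℝ) / (e + 1)) ≤ 1 / e := by
    rw [← Real.log_inv, inv_div]
    have := Real.log_le_sub_one_of_pos (show 0 < ((e : ℝ) + 1) / e by positivity)
    rw [add_div, div_self he'.ne'] at this ⊢
    linarith
  have b1 : e * (-Real.log ((e : ℝ) / (e + 1))) ≤ 1 := by
    have := mul_le_mul_of_nonneg_left b0 he'.le
    rwa [mul_one_div_cancel he'.ne'] at this
  have b2 : k * Real.log (2 * ((e : ℝ) + 1)) ≤ (e + 1) * η / 2 := by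
    have := mul_le_mul_of_nonneg_left he1 (Nat.cast_nonneg (α := ℝ) k)
    refine this.trans ?_
    have e3 : (k : ℝ) * (η / (4 * (k + 1)) * (2 * (e + 1))) =
        (k / (k + 1)) * ((e + 1) * η / 2) := by
      field_simp; ring
    rw [e3]
    exact mul_le_of_le_one_left (by positivity) (div_le_one_of_le₀ (by linarith) (by positivity))
  have b3 : k - Real.log m ≤ (e + 1) * η / 2 := by
    rw [div_le_iff₀ hη] at he2; linarith
  have b4 : (k : ℝ) * (e * (-Real.log ((e : ℝ) / (e + 1)))) ≤ k * 1 := by gcongr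
  rw [magnifyLoss, ← hmdef, Real.log_mul (by positivity) (by positivity),
    Real.log_mul (by positivity) (by positivity), Real.log_pow, Real.log_pow, Real.log_pow,
    one_div, Real.log_inv]
  linarith

theorem exists_log_le_mul {η : ℝ} (hη : 0 < η) : ∃ l : ℕ, 0 < l ∧ Real.log (l + 1) ≤ l * η := by
  have hT : Tendsto (fun e : ℕ => (e : ℝ) + 1) atTop atTop :=
    tendsto_atTop_add_const_right _ _ tendsto_natCast_atTop_atTop
  have ev1 := hT.eventually (eventually_log_le (c := η / 2) (by positivity))
  obtain ⟨l, hl1, hl⟩ := (ev1.and (eventually_gt_atTop 0)).exists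
  refine ⟨l, hl, hl1.trans ?_⟩
  have : (1 : ℝ) ≤ l := by exact_mod_cast hl
  nlinarith

/-- `N⁻¹ log P(y_N = ⌊y N⌋ / N)` for the urn with `s₀` black balls at the time `M`. -/
noncomputable def rate (f : ℝ → ℝ) (M s₀ : ℕ) (y : ℝ) (N : ℕ) : ℝ :=
  Real.log (law f M s₀ N ⌊y * N⌋₊) / N

/-- From the state `⌊y N⌋` at the time `N`, magnified by `d * j`, the urn reaches the state `⌊y N'⌋`
at the time `N'` at an exponential cost in the time left, if `j` is the largest integer for which
the magnification leaves enough time to add the balls that are missing. -/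
theorem exists_pow_le_trans_floor (hf : IsRegularUrn f k) {y : ℝ} (h0 : 0 < y) (h1 : y < 1) :
    ∃ (e₂ : ℝ) (B : ℕ), 0 < e₂ ∧ e₂ ≤ 1 ∧ ∀ N N' d j : ℕ, 0 < d → 2 * B + 1 ≤ N → 2 < y * N →
      4 ≤ j → j * (d * (N + B)) ≤ N' → N' < (j + 1) * (d * (N + B)) →
      ∃ b, N' = d * j * N + b ∧ (b : ℝ) ≤ j * d * B + d * (N + B) ∧
        e₂ ^ b ≤ trans f (d * j * N) (d * j * ⌊y * N⌋₊) b ⌊y * N'⌋₊ := by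
  have hm0 : 0 < min y (1 - y) := lt_min h0 (by linarith)
  have hy1 : 0 < 1 - y := by linarith
  obtain ⟨e₂, he₂0, he₂1, hpatch⟩ := exists_pow_le_trans hf (κ := min y (1 - y) / 4) (by positivity)
  obtain ⟨B, hB⟩ := exists_nat_gt (1 / (1 - y))
  have hB' : 1 < (1 - y) * B := by rwa [div_lt_iff₀' hy1] at hB
  refine ⟨e₂, B, he₂0, he₂1, fun N N' d j hd hNB q1 hj4 hj1 hj2 => ?_⟩
  have hN0 : (0 : ℝ) < N := by exact_mod_cast (by omega : 0 < N)
  have hd' : (0 : ℝ) < d := by exact_mod_cast hd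
  have hj4' : (4 : ℝ) ≤ j := by exact_mod_cast hj4
  have hj1' : (j : ℝ) * (d * (N + B)) ≤ N' := by exact_mod_cast hj1
  have hj2' : (N' : ℝ) < (j + 1) * (d * (N + B)) := by exact_mod_cast hj2
  have hd0 : (0 : ℝ) < d * j := mul_pos hd' (by linarith)
  have hBr : (2 : ℝ) * B + 1 ≤ N := by exact_mod_cast hNB
  set n := d * j * N with hn
  have hncast : (n : ℝ) = d * j * N := by rw [hn]; push_cast; ring
  have hnN' : n ≤ N' := by
    have : (n : ℝ) ≤ N' := by
      rw [hncast]
      have : 0 ≤ (d : ℝ) * j * B := by positivity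
      linarith
    exact_mod_cast this
  have hN'n : (N' : ℝ) ≤ 2 * n := by
    rw [hncast]
    have a1 : ((j : ℝ) + 1) * (N + B) ≤ 2 * (j * N) := by nlinarith
    have a2 := mul_le_mul_of_nonneg_left a1 hd'.le
    linarith
  obtain ⟨b, hb⟩ := Nat.exists_eq_add_of_le hnN'
  have hbr : (N' : ℝ) = n + b := by exact_mod_cast hb
  set s := d * j * ⌊y * N⌋₊ with hs
  have hscast : (s : ℝ) = d * j * ⌊y * N⌋₊ := by rw [hs]; push_cast; ring
  have fl1 : (⌊y * N⌋₊ : ℝ) ≤ y * N := Nat.floor_le (by positivity)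
  have fl2 : y * N < ⌊y * N⌋₊ + 1 := Nat.lt_floor_add_one _
  have fl3 : (⌊y * N'⌋₊ : ℝ) ≤ y * N' := Nat.floor_le (by positivity)
  have hnN'r : (n : ℝ) ≤ N' := by exact_mod_cast hnN'
  have hsN' : s ≤ ⌊y * N'⌋₊ := by
    refine Nat.le_floor ?_
    calc (s : ℝ) ≤ d * j * (y * N) := by rw [hscast]; gcongr
      _ = y * n := by rw [hncast]; ring
      _ ≤ y * N' := by gcongr
  obtain ⟨r, hr⟩ := Nat.exists_eq_add_of_le hsN'
  have hrb : r ≤ b := by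
    have a2 : (⌊y * N'⌋₊ : ℝ) = s + r := by exact_mod_cast hr
    have a3 : (d : ℝ) * j * (y * N - 1) ≤ s := by
      rw [hscast]; exact mul_le_mul_of_nonneg_left (by linarith) hd0.le
    have a4 : (d : ℝ) * j * ((1 - y) * N + 1) ≤ (1 - y) * N' := by
      calc (d : ℝ) * j * ((1 - y) * N + 1)
          ≤ (d : ℝ) * j * ((1 - y) * N + (1 - y) * B) :=
            mul_le_mul_of_nonneg_left (by linarith) hd0.le
        _ = (1 - y) * (j * (d * (N + B))) := by ring
        _ ≤ _ := mul_le_mul_of_nonneg_left hj1' hy1.le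
    have : (r : ℝ) ≤ b := by
      have a5 : (b : ℝ) = N' - d * j * N := by rw [← hncast]; linarith
      linarith
    exact_mod_cast this
  have hsn : s ≤ n := by
    rw [hs, hn]
    refine Nat.mul_le_mul_left _ ?_
    have : (⌊y * N⌋₊ : ℝ) ≤ N := fl1.trans (mul_le_of_le_one_left hN0.le h1.le)
    exact_mod_cast this
  have hn0 : 0 < n := Nat.mul_pos (Nat.mul_pos hd (by omega)) (by omega)
  have htr := hpatch n s b r hn0 hsn hrb
    (by
      rw [← hb, hscast]
      refine (mul_le_mul (by linarith [min_le_left y (1 - y)] : min y (1 - y) / 4 ≤ y / 4) hN'n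
        (by positivity) (by positivity)).trans ?_
      rw [hncast]
      have := mul_le_mul_of_nonneg_left (by linarith : y * N / 2 ≤ ⌊y * N⌋₊) hd0.le
      linarith)
    (by
      rw [← hb, hscast]
      refine (mul_le_mul (by linarith [min_le_right y (1 - y)] : min y (1 - y) / 4 ≤ (1 - y) / 4)
        hN'n (by positivity) (by positivity)).trans ?_
      rw [hncast]
      have a2 : 0 ≤ (1 - y) * N := mul_nonneg hy1.le hN0.le
      have := mul_le_mul_of_nonneg_left
        (by linarith : (1 - y) * N / 2 ≤ N - (⌊y * N⌋₊ : ℝ)) hd0.le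
      linarith)
  refine ⟨b, hb, ?_, by rw [hr]; exact htr⟩
  rw [hncast] at hbr
  linarith

/-- The rate at any large time almost bounds the rate at all much larger times from below, and
this for any two initial states. -/
theorem rate_sub_le_rate (hf : IsRegularUrn f k) {y : ℝ} (h0 : 0 < y) (h1 : y < 1)
    {M s₀ M₁ s₁ : ℕ} (hM : 0 < M) (h : s₀ ≤ M) (hM₁ : 0 < M₁) (h₁ : s₁ ≤ M₁) {η : ℝ}
    (hη : 0 < η) : ∃ N₀ : ℕ, ∀ N ≥ N₀, ∃ N₁ : ℕ, ∀ N' ≥ N₁,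
      rate f M s₀ y N - η ≤ rate f M₁ s₁ y N' := by
  -- The order of choice matters: the proportion `1 / (e + 1)` of the interior path, then the step
  -- length `l`, then `N`, which makes the initial and final stretches negligible.
  obtain ⟨e, he, hΛη⟩ := exists_neg_log_magnifyLoss_le hf h0 h1 (η := η / 8) (by positivity)
  obtain ⟨l, hl, hlη⟩ := exists_log_le_mul (η := η / 8) (by positivity)
  obtain ⟨T, J, c, hc0, hc1, hMT, hJ, hmag⟩ := law_pow_le_law_magnified hf h0 h1 h hM₁ h₁ he hl
  obtain ⟨e₂, B, he₂0, he₂1, hpatch⟩ := exists_pow_le_trans_floor hf h0 h1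
  obtain ⟨c', hc'0, hc'1, P, hMP, hP⟩ := exists_law_pos hf h0 h1 hM h
  have hlc : 0 ≤ -Real.log c := neg_nonneg.2 (Real.log_nonpos hc0.le hc1)
  have hle : 0 ≤ -Real.log e₂ := neg_nonneg.2 (Real.log_nonpos he₂0.le he₂1)
  obtain ⟨Q, hQ⟩ := exists_nat_gt (max (2 / y) (max ((T + l) * (-Real.log c) / (η / 4))
    (B * (-Real.log e₂) / (η / 8))))
  refine ⟨max (max T P) (max (2 * B + 1) Q), fun N hN => ?_⟩
  have hNT : T ≤ N := (le_max_left _ _).trans ((le_max_left _ _).trans hN)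
  have hNP : P ≤ N := (le_max_right _ _).trans ((le_max_left _ _).trans hN)
  have hNB : 2 * B + 1 ≤ N := (le_max_left _ _).trans ((le_max_right _ _).trans hN)
  have hNQ : Q ≤ N := (le_max_right _ _).trans ((le_max_right _ _).trans hN)
  have hQN : (Q : ℝ) ≤ N := by exact_mod_cast hNQ
  have hN0 : (0 : ℝ) < N := by exact_mod_cast (by omega : 0 < N)
  have q1 : 2 < y * N := by
    have := ((le_max_left _ _).trans_lt hQ).trans_le hQN
    rwa [div_lt_iff₀' h0] at this
  have q2 : (T + l) * (-Real.log c) ≤ N * (η / 4) := by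
    have := (((le_max_left _ _).trans (le_max_right _ _)).trans_lt hQ).trans_le hQN
    exact ((div_lt_iff₀ (by positivity)).1 this).le
  have q3 : B * (-Real.log e₂) ≤ N * (η / 8) := by
    have := (((le_max_right _ _).trans (le_max_right _ _)).trans_lt hQ).trans_le hQN
    exact ((div_lt_iff₀ (by positivity)).1 this).le
  obtain ⟨R, hR⟩ := exists_nat_gt ((e + 1) * (N + B) * (-Real.log e₂) / (η / 8))
  refine ⟨max (max J 4 * ((e + 1) * (N + B))) (max R 1), fun N' hN' => ?_⟩
  have hN'1 : max J 4 * ((e + 1) * (N + B)) ≤ N' := (le_max_left _ _).trans hN'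
  have hN'R : R ≤ N' := (le_max_left _ _).trans ((le_max_right _ _).trans hN')
  have hN'0 : 1 ≤ N' := (le_max_right _ _).trans ((le_max_right _ _).trans hN')
  have hN'pos : (0 : ℝ) < N' := by exact_mod_cast hN'0
  have q4 : (e + 1) * (N + B) * (-Real.log e₂) ≤ N' * (η / 8) := by
    have := hR.trans_le (show (R : ℝ) ≤ N' by exact_mod_cast hN'R)
    exact ((div_lt_iff₀ (by positivity)).1 this).le
  have hD0 : 0 < (e + 1) * (N + B) := Nat.mul_pos (by omega) (by omega)
  set j := N' / ((e + 1) * (N + B)) with hj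
  have hjmax : max J 4 ≤ j := (Nat.le_div_iff_mul_le hD0).2 hN'1
  have hjJ : J ≤ j := (le_max_left _ _).trans hjmax
  have hj2 : N' < (j + 1) * ((e + 1) * (N + B)) := by
    rw [add_mul, one_mul]; exact Nat.lt_div_mul_add (a := N') hD0
  obtain ⟨hM₁n, hlaw⟩ := hmag N hNT j hjJ
  obtain ⟨b, hb, hbB, htr⟩ := hpatch N N' (e + 1) j (by omega) hNB q1
    ((le_max_right _ _).trans hjmax) (Nat.div_mul_le_self _ _) hj2
  have hCK := law_mul_trans_le hf h₁ hM₁n ((e + 1) * j * ⌊y * N⌋₊) b ⌊y * N'⌋₊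
  rw [← hb] at hCK
  have hΛ := magnifyLoss_pos hf h0 h1 he
  have hp : 0 < law f M s₀ N ⌊y * N⌋₊ := (pow_pos hc'0 N).trans_le (hP N hNP)
  have hp1 : law f M s₀ N ⌊y * N⌋₊ ≤ 1 := law_le_one hf h _ _
  have hbase : 0 < law f M s₀ N ⌊y * N⌋₊ ^ e * c ^ ((e + 1) * (T + l)) *
        (magnifyLoss f k y e ^ l / (l + 1 : ℝ) ^ e) ^ (N / l) := by positivity
  have htotal := (mul_le_mul hlaw htr (pow_nonneg he₂0.le b) (law_nonneg hf h₁ _ _)).trans hCK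
  have hlog := Real.log_le_log (mul_pos (pow_pos hbase j) (pow_pos he₂0 b)) htotal
  rw [Real.log_mul (pow_pos hbase j).ne' (pow_pos he₂0 b).ne', Real.log_pow, Real.log_pow,
    Real.log_mul (by positivity) (by positivity), Real.log_mul (by positivity) (by positivity),
    Real.log_pow, Real.log_pow, Real.log_pow, Real.log_div (by positivity) (by positivity),
    Real.log_pow, Real.log_pow] at hlog
  -- Each of the four losses is a fraction of `η N'`.
  set X := -Real.log (law f M s₀ N ⌊y * N⌋₊) with hX
  have hX0 : 0 ≤ X := neg_nonneg.2 (Real.log_nonpos hp.le hp1)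
  have hjd : (j : ℝ) * (e + 1) * N ≤ N' := by
    have : (((e + 1) * j * N : ℕ) : ℝ) ≤ N' := by exact_mod_cast (by omega)
    push_cast at this; linarith
  have l1 : (j : ℝ) * (e * X) ≤ N' * (X / N) := by
    rw [mul_div_assoc', le_div_iff₀ hN0]
    have a1 : (j : ℝ) * (e + 1) * N * X ≤ N' * X := by gcongr
    have a2 : 0 ≤ (j : ℝ) * N * X := by positivity
    linarith
  have l2 : (j : ℝ) * (((e + 1) * (T + l) : ℕ) * (-Real.log c)) ≤ N' * (η / 4) := by
    push_cast
    calc (j : ℝ) * ((e + 1) * (T + l) * (-Real.log c))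
        = j * (e + 1) * ((T + l) * (-Real.log c)) := by ring
      _ ≤ j * (e + 1) * (N * (η / 4)) := by gcongr
      _ = j * (e + 1) * N * (η / 4) := by ring
      _ ≤ N' * (η / 4) := by gcongr
  have l3 : (j : ℝ) * ((N / l : ℕ) * (-(l * Real.log (magnifyLoss f k y e) -
      e * Real.log (l + 1)))) ≤ N' * (η / 4) := by
    have hl' : (0 : ℝ) < l := by exact_mod_cast hl
    have a1 : ((N / l : ℕ) : ℝ) ≤ N / l := Nat.cast_div_le
    have a2 : -(l * Real.log (magnifyLoss f k y e) - e * Real.log (l + 1)) ≤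
        l * ((e + 1) * (η / 4)) := by
      have := mul_le_mul_of_nonneg_left hΛη hl'.le
      have := mul_le_mul_of_nonneg_left hlη (Nat.cast_nonneg (α := ℝ) e)
      have : 0 ≤ (l : ℝ) * (η / 8) := by positivity
      linarith
    calc (j : ℝ) * ((N / l : ℕ) * (-(l * Real.log (magnifyLoss f k y e) - e * Real.log (l + 1))))
        ≤ j * ((N / l : ℕ) * (l * ((e + 1) * (η / 4)))) := by gcongr
      _ ≤ j * (N / l * (l * ((e + 1) * (η / 4)))) := by gcongr
      _ = j * (e + 1) * N * (η / 4) := by field_simp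
      _ ≤ N' * (η / 4) := by gcongr
  have l4 : (b : ℝ) * (-Real.log e₂) ≤ N' * (η / 4) := by
    push_cast at hbB
    calc (b : ℝ) * (-Real.log e₂) ≤ (j * (e + 1) * B + (e + 1) * (N + B)) * (-Real.log e₂) := by
          gcongr
      _ = j * (e + 1) * (B * (-Real.log e₂)) + (e + 1) * (N + B) * (-Real.log e₂) := by ring
      _ ≤ j * (e + 1) * (N * (η / 8)) + N' * (η / 8) := by gcongr
      _ = j * (e + 1) * N * (η / 8) + N' * (η / 8) := by ring
      _ ≤ N' * (η / 8) + N' * (η / 8) := by gcongr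
      _ = _ := by ring
  rw [rate, rate, le_div_iff₀ hN'pos]
  refine le_trans ?_ hlog
  have hXlog : Real.log (law f M s₀ N ⌊y * N⌋₊) = -X := by rw [hX, neg_neg]
  rw [hXlog]
  have : (-X / N - η) * N' = -(N' * (X / N)) - N' * η := by ring
  rw [this]
  have hη' : 0 ≤ N' * (η / 4) := by positivity
  linarith

theorem rate_nonpos (hf : IsRegularUrn f k) {M s₀ : ℕ} (h : s₀ ≤ M) (y : ℝ) (N : ℕ) :
    rate f M s₀ y N ≤ 0 :=
  div_nonpos_of_nonpos_of_nonneg (Real.log_nonpos (law_nonneg hf h _ _) (law_le_one hf h _ _))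
    (Nat.cast_nonneg _)

theorem exists_le_rate (hf : IsRegularUrn f k) {y : ℝ} (h0 : 0 < y) (h1 : y < 1) {M s₀ : ℕ}
    (hM : 0 < M) (h : s₀ ≤ M) : ∃ C : ℝ, ∀ᶠ N in atTop, C ≤ rate f M s₀ y N := by
  obtain ⟨c, hc0, -, P, -, hP⟩ := exists_law_pos hf h0 h1 hM h
  refine ⟨Real.log c, ?_⟩
  filter_upwards [eventually_ge_atTop P, eventually_gt_atTop 0] with N hN hN0
  rw [rate, le_div_iff₀ (by exact_mod_cast hN0), mul_comm, ← Real.log_pow]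
  exact Real.log_le_log (pow_pos hc0 _) (hP N hN)

/-- The entropy density exists at interior points and does not depend on the initial state. -/
theorem exists_tendsto_rate (hf : IsRegularUrn f k) {y : ℝ} (h0 : 0 < y) (h1 : y < 1) :
    ∃ L : ℝ, ∀ M s₀ : ℕ, 0 < M → s₀ ≤ M → Tendsto (rate f M s₀ y) atTop (𝓝 L) := by
  have hbdd : ∀ M s₀ : ℕ, 0 < M → s₀ ≤ M → IsBoundedUnder (· ≤ ·) atTop (rate f M s₀ y) ∧
      IsBoundedUnder (· ≥ ·) atTop (rate f M s₀ y) := fun M s₀ hM h => by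
    obtain ⟨C, hC⟩ := exists_le_rate hf h0 h1 hM h
    exact ⟨isBoundedUnder_of ⟨0, rate_nonpos hf h y⟩, ⟨C, hC⟩⟩
  have hkey : ∀ M s₀ M₁ s₁ : ℕ, 0 < M → s₀ ≤ M → 0 < M₁ → s₁ ≤ M₁ →
      limsup (rate f M s₀ y) atTop ≤ liminf (rate f M₁ s₁ y) atTop := by
    intro M s₀ M₁ s₁ hM h hM₁ h₁
    refine le_of_forall_pos_le_add fun η hη => ?_
    obtain ⟨N₀, hN₀⟩ := rate_sub_le_rate hf h0 h1 hM h hM₁ h₁ hη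
    refine limsup_le_of_le (hbdd M s₀ hM h).2.isCoboundedUnder_le ?_
    filter_upwards [eventually_ge_atTop N₀] with N hN
    obtain ⟨N₁, hN₁⟩ := hN₀ N hN
    have : rate f M s₀ y N - η ≤ liminf (rate f M₁ s₁ y) atTop :=
      le_liminf_of_le (hbdd M₁ s₁ hM₁ h₁).1.isCoboundedUnder_ge
        (eventually_atTop.2 ⟨N₁, hN₁⟩)
    linarith
  have hle : ∀ M s₀ : ℕ, 0 < M → s₀ ≤ M →
      liminf (rate f M s₀ y) atTop ≤ limsup (rate f M s₀ y) atTop := fun M s₀ hM h =>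
    liminf_le_limsup (hbdd M s₀ hM h).1 (hbdd M s₀ hM h).2
  refine ⟨limsup (rate f 1 0 y) atTop, fun M s₀ hM h => ?_⟩
  refine tendsto_of_liminf_eq_limsup ?_ ?_ (hbdd M s₀ hM h).1 (hbdd M s₀ hM h).2
  · exact le_antisymm ((hle M s₀ hM h).trans (hkey M s₀ 1 0 hM h one_pos zero_le_one |>.trans
      (hle 1 0 one_pos zero_le_one))) (hkey 1 0 M s₀ one_pos zero_le_one hM h)
  · exact le_antisymm ((hkey M s₀ 1 0 hM h one_pos zero_le_one).trans
      (hle 1 0 one_pos zero_le_one)) ((hkey 1 0 M s₀ one_pos zero_le_one hM h).trans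
      (hle M s₀ hM h))

/-! ### Vanishing of the entropy density between two fixed points -/

theorem tendsto_floor_div {x : ℝ} (hx : 0 ≤ x) :
    Tendsto (fun N : ℕ => (⌊x * N⌋₊ : ℝ) / N) atTop (𝓝 x) :=
  (tendsto_nat_floor_mul_div_atTop hx).comp tendsto_natCast_atTop_atTop

theorem tendsto_log_succ_div :
    Tendsto (fun N : ℕ => Real.log ((N : ℝ) + 1) / N) atTop (𝓝 0) := by
  rw [Metric.tendsto_atTop]
  intro ε hε
  have hT : Tendsto (fun e : ℕ => (e : ℝ) + 1) atTop atTop :=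
    tendsto_atTop_add_const_right _ _ tendsto_natCast_atTop_atTop
  obtain ⟨N₀, hN₀⟩ := eventually_atTop.1
    ((hT.eventually (eventually_log_le (c := ε / 4) (by positivity))).and (eventually_gt_atTop 0))
  refine ⟨N₀, fun N hN => ?_⟩
  obtain ⟨h1, h2⟩ := hN₀ N hN
  have h3 : (1 : ℝ) ≤ N := by exact_mod_cast h2
  have h4 : 0 ≤ Real.log ((N : ℝ) + 1) := Real.log_nonneg (by linarith)
  rw [Real.dist_eq, sub_zero, abs_of_nonneg (by positivity), div_lt_iff₀ (by linarith)]
  nlinarith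

/-- A transition whose empirical frequencies are bounded by multiples of the probabilities of the
two colours. -/
theorem pow_le_mul_trans (hf : IsRegularUrn f k) {α β μ : ℝ} (hα : 0 ≤ α) (hβ : 0 ≤ β)
    (hμ : 0 ≤ μ) {n s r w : ℕ} (hs : s ≤ n) (hrw : 0 < r + w)
    (hr : μ * r ≤ α * (r + w : ℕ)) (hw : μ * w ≤ β * (r + w : ℕ))
    (hb : ∀ j < r + w, ∀ i ≤ j, α ≤ f (((s + i : ℕ) : ℝ) / ((n + j : ℕ) : ℝ)) ∧
      β ≤ 1 - f (((s + i : ℕ) : ℝ) / ((n + j : ℕ) : ℝ))) :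
    μ ^ (r + w) ≤ ((r + w : ℕ) + 1 : ℝ) * trans f n s (r + w) (s + r) := by
  have h1 := choose_mul_le_trans hf hα hβ (r + w) r hs hb
  rw [Nat.add_sub_cancel_left] at h1
  have h2 : (((r + w : ℕ) : ℝ)) ^ (r + w) ≤
      ((r + w : ℕ) + 1 : ℝ) * (((r + w).choose r : ℝ) * (r : ℝ) ^ r * (w : ℝ) ^ w) := by
    exact_mod_cast pow_le_choose_mul r w
  have hb0 : (0 : ℝ) < ((r + w : ℕ) : ℝ) := by exact_mod_cast hrw
  have h3 := pow_le_pow_left₀ (by positivity) hr r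
  have h4 := pow_le_pow_left₀ (by positivity) hw w
  rw [mul_pow, mul_pow] at h3 h4
  refine le_trans ?_ (mul_le_mul_of_nonneg_left h1 (by positivity))
  refine le_of_mul_le_mul_right ?_ (pow_pos hb0 (r + w))
  calc μ ^ (r + w) * ((r + w : ℕ) : ℝ) ^ (r + w)
      ≤ μ ^ (r + w) *
        (((r + w : ℕ) + 1 : ℝ) * (((r + w).choose r : ℝ) * (r : ℝ) ^ r * (w : ℝ) ^ w)) := by
        gcongr
    _ = ((r + w : ℕ) + 1 : ℝ) * ((r + w).choose r : ℝ) *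
        ((μ ^ r * (r : ℝ) ^ r) * (μ ^ w * (w : ℝ) ^ w)) := by rw [pow_add]; ring
    _ ≤ ((r + w : ℕ) + 1 : ℝ) * ((r + w).choose r : ℝ) *
        ((α ^ r * ((r + w : ℕ) : ℝ) ^ r) * (β ^ w * ((r + w : ℕ) : ℝ) ^ w)) := by gcongr
    _ = _ := by rw [pow_add ((r + w : ℕ) : ℝ)]; ring

/-- One step of Euler's method for the flow of `π(y) - y` costs only the second order in the step
size. -/
theorem euler_step_le (hf : IsRegularUrn f k) {M s₀ : ℕ} (hM : 0 < M) (h : s₀ ≤ M) {L : ℝ → ℝ}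
    (hL : ∀ y, 0 < y → y < 1 → Tendsto (rate f M s₀ y) atTop (𝓝 (L y)))
    {x y ε : ℝ} (hx0 : 0 < x) (hx1 : x < 1) (hy0 : 0 < y) (hy1 : y < 1) (hε : 0 < ε)
    (hxy : (1 + ε) * y = x + ε * f x) :
    L x - 2 * (k + 1) * ε ^ 2 ≤ (1 + ε) * L y := by
  have hfx0 := hf.pos hx0.le hx1
  have hfx1 := hf.lt_one hx0 hx1.le
  set q : ℝ := (1 + ε)⁻¹ with hq
  have hq0 : 0 < q := by positivity
  have hqε : (1 + ε) * q = 1 := mul_inv_cancel₀ (by positivity)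
  have hq1 : q < 1 := inv_lt_one_of_one_lt₀ (by linarith)
  obtain ⟨c, hc0, -, P, hMP, hP⟩ := exists_law_pos hf hx0 hx1 hM h
  set μ : ℝ := ((1 + 2 * ε)⁻¹) ^ (k + 1) with hμ
  have hμ0 : 0 < μ := by positivity
  set lam : ℝ := (1 + 2 * ε)⁻¹ with hlam
  have hlamq : lam < q := inv_strictAnti₀ (by positivity) (by linarith)
  have hlam0 : 0 < lam := by positivity
  -- The intermediate time and state, and their asymptotics.
  set n : ℕ → ℕ := fun N => ⌊q * N⌋₊ with hn
  have tn : Tendsto (fun N => (n N : ℝ) / N) atTop (𝓝 q) := tendsto_floor_div hq0.le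
  have hnN : ∀ N, n N ≤ N := fun N => by
    have : (n N : ℝ) ≤ N := (Nat.floor_le (by positivity)).trans
      (mul_le_of_le_one_left (Nat.cast_nonneg _) hq1.le)
    exact_mod_cast this
  have tninf : Tendsto n atTop atTop := tendsto_nat_floor_atTop.comp
    (tendsto_natCast_atTop_atTop.const_mul_atTop hq0)
  have ts' : Tendsto (fun N => (⌊x * n N⌋₊ : ℝ) / N) atTop (𝓝 (x * q)) := by
    have := ((tendsto_floor_div hx0.le).comp tninf).mul tn
    refine this.congr' ?_
    filter_upwards [tninf.eventually_gt_atTop 0] with N hN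
    have : (0 : ℝ) < n N := by exact_mod_cast hN
    simp only [Function.comp]
    field_simp
  have ts : Tendsto (fun N : ℕ => (⌊y * N⌋₊ : ℝ) / N) atTop (𝓝 y) := tendsto_floor_div hy0.le
  have hyq : y - x * q = (1 - q) * f x := by
    have : y = x * q + ε * q * f x := by
      calc y = ((1 + ε) * y) * q := by linear_combination -y * hqε
        _ = _ := by rw [hxy]; ring
    rw [this]; linear_combination (f x) * hqε
  have h1q : 0 < 1 - q := by linarith
  have hcomb : 0 < (1 - q) * f x := by positivity
  have hcomb' : 0 < (1 - q) * (1 - f x) := mul_pos h1q (by linarith)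
  have hμlam : μ = lam ^ k * lam := by rw [hμ, pow_succ]
  have hlam1 : lam < 1 := hlamq.trans hq1
  have ev1 : ∀ᶠ N : ℕ in atTop, (⌊x * n N⌋₊ : ℝ) / N < (⌊y * N⌋₊ : ℝ) / N :=
    ts'.eventually_lt ts (by linarith)
  have ev2 : ∀ᶠ N : ℕ in atTop, (⌊y * N⌋₊ : ℝ) / N - (⌊x * n N⌋₊ : ℝ) / N < 1 - (n N : ℝ) / N :=
    (ts.sub ts').eventually_lt (tendsto_const_nhds.sub tn) (by rw [hyq]; linarith)
  have ev3 : ∀ᶠ N : ℕ in atTop, lam * x < (⌊x * n N⌋₊ : ℝ) / N :=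
    ts'.eventually_const_lt (by rw [mul_comm x]; gcongr)
  have ev4 : ∀ᶠ N : ℕ in atTop, lam * (1 - x) < (n N : ℝ) / N - (⌊x * n N⌋₊ : ℝ) / N :=
    (tn.sub ts').eventually_const_lt (by nlinarith)
  have ev5 : ∀ᶠ N : ℕ in atTop, lam * ((⌊y * N⌋₊ : ℝ) / N - (⌊x * n N⌋₊ : ℝ) / N) <
      f x * (1 - (n N : ℝ) / N) :=
    ((ts.sub ts').const_mul lam).eventually_lt ((tendsto_const_nhds.sub tn).const_mul (f x))
      (by rw [hyq, mul_comm (f x)]; exact mul_lt_of_lt_one_left hcomb hlam1)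
  have ev6 : ∀ᶠ N : ℕ in atTop,
      lam * ((1 - (n N : ℝ) / N) - ((⌊y * N⌋₊ : ℝ) / N - (⌊x * n N⌋₊ : ℝ) / N)) <
      (1 - f x) * (1 - (n N : ℝ) / N) :=
    (((tendsto_const_nhds.sub tn).sub (ts.sub ts')).const_mul lam).eventually_lt
      ((tendsto_const_nhds.sub tn).const_mul (1 - f x))
      (by
        rw [hyq, show 1 - q - (1 - q) * f x = (1 - q) * (1 - f x) by ring, mul_comm (1 - f x)]
        exact mul_lt_of_lt_one_left hcomb' hlam1)
  have hmain : ∀ᶠ N : ℕ in atTop, (n N : ℝ) / N * rate f M s₀ x (n N) +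
      (1 - (n N : ℝ) / N) * Real.log μ - Real.log ((N : ℝ) + 1) / N ≤ rate f M s₀ y N := by
    filter_upwards [ev1, ev2, ev3, ev4, ev5, ev6, eventually_gt_atTop 0,
      tninf.eventually_ge_atTop P, tninf.eventually_gt_atTop 0] with N e1 e2 e3 e4 e5 e6 hN hNP hn0
    have hN' : (0 : ℝ) < N := by exact_mod_cast hN
    have hn' : (0 : ℝ) < n N := by exact_mod_cast hn0
    have hsn : ⌊x * n N⌋₊ ≤ n N := by
      have : (⌊x * n N⌋₊ : ℝ) ≤ n N := (Nat.floor_le (by positivity)).trans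
        (mul_le_of_le_one_left hn'.le hx1.le)
      exact_mod_cast this
    set s' := ⌊x * n N⌋₊ with hs'
    rw [div_lt_div_iff_of_pos_right hN'] at e1
    rw [← sub_div, one_sub_div hN'.ne', div_lt_div_iff_of_pos_right hN'] at e2
    rw [lt_div_iff₀ hN'] at e3
    rw [← sub_div, lt_div_iff₀ hN'] at e4
    rw [← sub_div, one_sub_div hN'.ne', mul_div_assoc', mul_div_assoc',
      div_lt_div_iff_of_pos_right hN'] at e5
    rw [← sub_div, one_sub_div hN'.ne', ← sub_div, mul_div_assoc', mul_div_assoc',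
      div_lt_div_iff_of_pos_right hN'] at e6
    obtain ⟨r, hr⟩ := Nat.exists_eq_add_of_lt (show s' < ⌊y * N⌋₊ by exact_mod_cast e1)
    obtain ⟨b, hb⟩ := Nat.exists_eq_add_of_le (hnN N)
    have hrc : (⌊y * N⌋₊ : ℝ) = s' + (r + 1 : ℕ) := by rw [hr]; push_cast; ring
    have hbc : (N : ℝ) = n N + b := by exact_mod_cast hb
    have hrb : r + 1 ≤ b := by
      have : ((r + 1 : ℕ) : ℝ) < b := by rw [hrc, hbc] at e2; linarith
      exact_mod_cast this.le
    obtain ⟨w, rfl⟩ := Nat.exists_eq_add_of_le hrb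
    have htr := pow_le_mul_trans hf (α := lam ^ k * f x) (β := lam ^ k * (1 - f x)) (μ := μ)
      (n := n N) (s := s') (r := r + 1) (w := w)
      (by positivity) (mul_nonneg (by positivity) (by linarith)) hμ0.le hsn (by omega)
      (by
        have : lam * ((r + 1 : ℕ) : ℝ) ≤ f x * (r + 1 + w : ℕ) := by
          rw [hrc] at e5; rw [hbc] at e5; linarith
        rw [hμlam, mul_assoc, mul_assoc]
        gcongr)
      (by
        have : lam * (w : ℝ) ≤ (1 - f x) * (r + 1 + w : ℕ) := by
          rw [hrc] at e6; rw [hbc] at e6; push_cast at e6 ⊢; linarith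
        rw [hμlam, mul_assoc, mul_assoc]
        gcongr)
      (fun j hj i hi => by
        have hd : (0 : ℝ) < ((n N + j : ℕ) : ℝ) := by positivity
        have hjN : ((n N + j : ℕ) : ℝ) ≤ N := by
          exact_mod_cast (by omega : n N + j ≤ N)
        have hij : (i : ℝ) ≤ j := by exact_mod_cast hi
        have g1 : lam * x * ((n N + j : ℕ) : ℝ) ≤ lam * x * N := by gcongr
        have g2 : lam * (1 - x) * ((n N + j : ℕ) : ℝ) ≤ lam * (1 - x) * N :=
          mul_le_mul_of_nonneg_left hjN (mul_nonneg hlam0.le (by linarith))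
        refine hf.scale x _ lam hx0.le hx1.le hlam0.le ?_ ?_
        · rw [le_div_iff₀ hd]; push_cast at *; linarith [Nat.cast_nonneg (α := ℝ) i]
        · rw [one_sub_div hd.ne', le_div_iff₀ hd]; push_cast at *; linarith)
    have hCK := law_mul_trans_le hf h (hMP.trans hNP) s' (r + 1 + w) ⌊y * N⌋₊
    rw [← hb] at hCK
    rw [show s' + (r + 1) = ⌊y * N⌋₊ by omega] at htr
    have hlaw0 : 0 < law f M s₀ (n N) s' := (pow_pos hc0 _).trans_le (hP _ hNP)
    have hN1 : ((r + 1 + w : ℕ) : ℝ) + 1 ≤ (N : ℝ) + 1 := by rw [hbc]; linarith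
    have htrnn := trans_nonneg hf (r + 1 + w) (n := n N) (s := s') ⌊y * N⌋₊ hsn
    have htr' : μ ^ (r + 1 + w) ≤ ((N : ℝ) + 1) * trans f (n N) s' (r + 1 + w) ⌊y * N⌋₊ :=
      htr.trans (mul_le_mul_of_nonneg_right hN1 htrnn)
    have htot : law f M s₀ (n N) s' * μ ^ (r + 1 + w) ≤ ((N : ℝ) + 1) * law f M s₀ N ⌊y * N⌋₊ := by
      calc _ ≤ law f M s₀ (n N) s' *
            (((N : ℝ) + 1) * trans f (n N) s' (r + 1 + w) ⌊y * N⌋₊) := by gcongr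
        _ = ((N : ℝ) + 1) * (law f M s₀ (n N) s' * trans f (n N) s' (r + 1 + w) ⌊y * N⌋₊) := by
            ring
        _ ≤ _ := by gcongr
    have hpos : 0 < law f M s₀ (n N) s' * μ ^ (r + 1 + w) := by positivity
    have hlawN : 0 < law f M s₀ N ⌊y * N⌋₊ :=
      pos_of_mul_pos_right (hpos.trans_le htot) (by positivity)
    have hlog := Real.log_le_log hpos htot
    rw [Real.log_mul hlaw0.ne' (by positivity), Real.log_pow,
      Real.log_mul (by positivity) hlawN.ne'] at hlog
    have hbN : ((r + 1 + w : ℕ) : ℝ) = N - n N := by linarith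
    rw [hbN] at hlog
    simp only [rate]
    rw [← hs', one_sub_div hN'.ne', div_mul_div_comm, mul_comm (n N : ℝ),
      mul_div_mul_right _ _ hn'.ne', div_mul_eq_mul_div, ← add_div, ← sub_div,
      div_le_div_iff_of_pos_right hN']
    linarith
  have hlim := ((tn.mul ((hL x hx0 hx1).comp tninf)).add
    ((tn.const_sub 1).mul_const (Real.log μ))).sub tendsto_log_succ_div
  have hfin := le_of_tendsto_of_tendsto hlim (hL y hy0 hy1) hmain
  have hlogμ : -(2 * (k + 1) * ε) ≤ Real.log μ := by
    rw [hμ, Real.log_pow, hlam, Real.log_inv]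
    have := Real.log_le_sub_one_of_pos (show 0 < 1 + 2 * ε by positivity)
    have h3 : ((k : ℝ) + 1) * Real.log (1 + 2 * ε) ≤ (k + 1) * (2 * ε) := by
      gcongr; linarith
    push_cast
    linarith
  have h4 := mul_le_mul_of_nonneg_left hfin (show 0 ≤ 1 + ε by positivity)
  have h5 : (1 + ε) * (q * L x + (1 - q) * Real.log μ - 0) = L x + ε * Real.log μ := by
    linear_combination (L x - Real.log μ) * hqε
  rw [h5] at h4
  have h6 := mul_le_mul_of_nonneg_left hlogμ hε.le
  linarith

/-- Between two fixed points of the urn function the entropy density vanishes: the Euler step maps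
the interval between them onto itself, so that the infimum of the entropy density gains a term of
the first order in the step size and loses one of the second. -/
theorem rate_limit_eq_zero (hf : IsRegularUrn f k) {M s₀ : ℕ} (hM : 0 < M) (h : s₀ ≤ M) {L : ℝ → ℝ}
    (hL : ∀ y, 0 < y → y < 1 → Tendsto (rate f M s₀ y) atTop (𝓝 (L y)))
    {a b : ℝ} (ha0 : 0 < a) (hb1 : b < 1) (hfa : f a = a) (hfb : f b = b) :
    ∀ y ∈ Icc a b, L y = 0 := by
  intro y hy
  have hab : a ≤ b := hy.1.trans hy.2
  have hin : ∀ x ∈ Icc a b, 0 < x ∧ x < 1 := fun x hx => ⟨ha0.trans_le hx.1, hx.2.trans_lt hb1⟩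
  have hL0 : ∀ x ∈ Icc a b, L x ≤ 0 := fun x hx =>
    le_of_tendsto' (hL x (hin x hx).1 (hin x hx).2) (rate_nonpos hf h x)
  obtain ⟨c, hc0, hc1, P, hMP, hP⟩ := exists_pow_le_law hf hM h
    (κ := min (a / 2) (1 - b)) (lt_min (by linarith) (by linarith))
  obtain ⟨Q, hQ⟩ := exists_nat_gt (2 / a)
  have hbdd : BddBelow (L '' Icc a b) := by
    refine ⟨Real.log c, ?_⟩
    rintro _ ⟨x, hx, rfl⟩
    refine ge_of_tendsto (hL x (hin x hx).1 (hin x hx).2) ?_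
    filter_upwards [eventually_ge_atTop P, eventually_gt_atTop 0, eventually_ge_atTop Q]
      with N hN hN0 hNQ
    have hN' : (0 : ℝ) < N := by exact_mod_cast hN0
    rw [rate, le_div_iff₀ hN', mul_comm, ← Real.log_pow]
    have a1 : (Q : ℝ) ≤ N := by exact_mod_cast hNQ
    have a2 : 2 < a * N := by rw [div_lt_iff₀' ha0] at hQ; nlinarith
    have a3 : x * N < ⌊x * N⌋₊ + 1 := Nat.lt_floor_add_one _
    have a4 : (⌊x * N⌋₊ : ℝ) ≤ x * N := Nat.floor_le (mul_nonneg (hin x hx).1.le hN'.le)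
    have a5 : a * N ≤ x * N := by gcongr; exact hx.1
    have a6 : x * N ≤ b * N := by gcongr; exact hx.2
    refine Real.log_le_log (pow_pos hc0 _) (hP N hN _ ?_ ?_)
    · have := mul_le_mul_of_nonneg_right (min_le_left (a / 2) (1 - b)) hN'.le
      linarith
    · have := mul_le_mul_of_nonneg_right (min_le_right (a / 2) (1 - b)) hN'.le
      linarith
  set m := sInf (L '' Icc a b) with hm
  have hmle : ∀ x ∈ Icc a b, m ≤ L x := fun x hx => csInf_le hbdd ⟨x, hx, rfl⟩
  have hkey : ∀ ε > 0, -(2 * (k + 1) * ε) ≤ m := by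
    intro ε hε
    have hstep : ∀ x ∈ Icc a b, m - 2 * (k + 1) * ε ^ 2 ≤ (1 + ε) * L x := by
      intro x hx
      have hcont : ContinuousOn (fun z => (1 + ε)⁻¹ * (z + ε * f z)) (Icc a b) :=
        (continuous_const.mul (continuous_id.add (continuous_const.mul hf.cont))).continuousOn
      have hmem : x ∈ Icc ((1 + ε)⁻¹ * (a + ε * f a)) ((1 + ε)⁻¹ * (b + ε * f b)) := by
        rw [hfa, hfb, show a + ε * a = (1 + ε) * a by ring, show b + ε * b = (1 + ε) * b by ring,
          inv_mul_cancel_left₀ (by positivity), inv_mul_cancel_left₀ (by positivity)]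
        exact hx
      obtain ⟨z, hz, hzx⟩ := intermediate_value_Icc hab hcont hmem
      have := euler_step_le hf hM h hL (hin z hz).1 (hin z hz).2 (hin x hx).1 (hin x hx).2 hε
        (by rw [← hzx]; exact mul_inv_cancel_left₀ (by positivity) _)
      linarith [hmle z hz]
    have h1 : (m - 2 * (k + 1) * ε ^ 2) / (1 + ε) ≤ m := by
      refine le_csInf ⟨_, y, hy, rfl⟩ ?_
      rintro _ ⟨x, hx, rfl⟩
      rw [div_le_iff₀ (by positivity), mul_comm (L x)]
      exact hstep x hx
    rw [div_le_iff₀ (by positivity)] at h1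
    have h2 : ε * -(2 * (k + 1) * ε) ≤ ε * m := by linarith
    exact le_of_mul_le_mul_left h2 hε
  have hm0 : 0 ≤ m := by
    refine le_of_forall_pos_le_add fun δ hδ => ?_
    have := hkey (δ / (2 * (k + 1))) (by positivity)
    rw [mul_div_cancel₀ _ (by positivity)] at this
    linarith
  exact le_antisymm (hL0 y hy) (hm0.trans (hmle y hy))

/-! ### Exponential decay away from the stable region -/

/-- The densities above `b` are exponentially unlikely. -/
def TailDecay (f : ℝ → ℝ) (M s₀ : ℕ) (b : ℝ) : Prop :=
  ∃ c : ℝ, 0 < c ∧ ∀ᶠ N : ℕ in atTop, ∀ s : ℕ, b * N ≤ s → law f M s₀ N s ≤ Real.exp (-(c * N))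

theorem TailDecay.mono {M s₀ : ℕ} {b b' : ℝ} (hb : TailDecay f M s₀ b) (h : b ≤ b') :
    TailDecay f M s₀ b' := by
  obtain ⟨c, hc, H⟩ := hb
  refine ⟨c, hc, H.mono fun N hN s hs => hN s (le_trans ?_ hs)⟩
  gcongr

theorem tailDecay_of_one_lt (f : ℝ → ℝ) {M s₀ : ℕ} (h : s₀ ≤ M) {b : ℝ} (hb : 1 < b) :
    TailDecay f M s₀ b := by
  refine ⟨1, one_pos, ?_⟩
  filter_upwards [eventually_ge_atTop M, eventually_gt_atTop 0] with N hN hN0 s hs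
  have hN' : (0 : ℝ) < N := by exact_mod_cast hN0
  have : (N : ℝ) < s := by nlinarith
  rw [law_eq_zero_of_gt f h hN (by exact_mod_cast this)]
  positivity

/-- Chernoff's bound for a number of black balls exceeding its mean by `η / 2` per step. -/
theorem trans_le_exp (hf : IsRegularUrn f k) {q η : ℝ} (hq0 : 0 ≤ q) (hq1 : q ≤ 1) (hη0 : 0 < η)
    (hη1 : η ≤ 1) {n s t r : ℕ} (hs : s ≤ n) (hr : (q + η / 2) * t ≤ r)
    (hb : ∀ j < t, ∀ i ≤ j, f (((s + i : ℕ) : ℝ) / ((n + j : ℕ) : ℝ)) ≤ q) :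
    trans f n s t (s + r) ≤ Real.exp (-(η ^ 2 / 32 * t)) := by
  -- The exponential moment with base `1 + η / 4` is of the right order for small `η`.
  have hx : (1 : ℝ) ≤ 1 + η / 4 := by linarith
  have h1 := trans_mul_pow_le hf hx hq0 t r hs hb
  have h2 : (1 + (1 + η / 4 - 1) * q) ^ t ≤ Real.exp (t * (η / 4 * q)) := by
    rw [Real.exp_nat_mul]
    refine pow_le_pow_left₀ (by positivity) ?_ _
    have := Real.add_one_le_exp (η / 4 * q)
    linarith
  have h3 : Real.exp (r * (η / 4 / (1 + η / 4))) ≤ (1 + η / 4) ^ r := by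
    rw [Real.exp_nat_mul]
    refine pow_le_pow_left₀ (Real.exp_pos _).le ?_ _
    rw [← Real.le_log_iff_exp_le (by linarith)]
    have := Real.one_sub_inv_le_log_of_pos (show 0 < 1 + η / 4 by linarith)
    refine le_trans (le_of_eq ?_) this
    field_simp
    ring
  have hT := trans_nonneg hf t (n := n) (s := s) (s + r) hs
  have h4 : trans f n s t (s + r) * Real.exp (r * (η / 4 / (1 + η / 4))) ≤
      Real.exp (t * (η / 4 * q)) := (mul_le_mul_of_nonneg_left h3 hT).trans (h1.trans h2)
  rw [← le_div_iff₀ (Real.exp_pos _), ← Real.exp_sub] at h4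
  refine h4.trans (Real.exp_le_exp.2 ?_)
  have ht : (0 : ℝ) ≤ t := Nat.cast_nonneg t
  have h5 : (q + η / 2) * t * (η / 4 / (1 + η / 4)) ≤ r * (η / 4 / (1 + η / 4)) := by gcongr
  have h6 : η / 4 * q + η ^ 2 / 32 ≤ (q + η / 2) * (η / 4 / (1 + η / 4)) := by
    rw [mul_div_assoc', le_div_iff₀ (by linarith)]
    nlinarith [mul_nonneg hη0.le (sub_nonneg.2 hq1),
      mul_nonneg (mul_nonneg hη0.le hη0.le) (sub_nonneg.2 hq1),
      mul_nonneg (mul_nonneg hη0.le hη0.le) (sub_nonneg.2 hη1)]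
  have h7 := mul_le_mul_of_nonneg_right h6 ht
  linarith

theorem eventually_succ_mul_exp_le {c : ℝ} (hc : 0 < c) :
    ∀ᶠ N : ℕ in atTop, ((N : ℝ) + 1) * Real.exp (-(2 * c * N)) ≤ Real.exp (-(c * N)) := by
  filter_upwards [tendsto_log_succ_div.eventually_lt_const hc, eventually_gt_atTop 0] with N hN hN0
  have hN' : (0 : ℝ) < N := by exact_mod_cast hN0
  rw [div_lt_iff₀ hN'] at hN
  rw [← Real.exp_log (show (0 : ℝ) < N + 1 by positivity), ← Real.exp_add, Real.exp_le_exp]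
  linarith

/-- If the drift `π(z) - z` is at most `-2η` on `[a, 1]`, then the exponential decay spreads
downwards by a fixed amount: within a time `η N / 2` a density just below `b` falls appreciably. -/
theorem TailDecay.step (hf : IsRegularUrn f k) {M s₀ : ℕ} (h : s₀ ≤ M) {a b η : ℝ} (ha : 0 ≤ a)
    (hη0 : 0 < η) (hη1 : η ≤ 1) (hdrift : ∀ z, a ≤ z → z ≤ 1 → f z ≤ z - 2 * η)
    (hab : a + η / 2 ≤ b - η ^ 2 / 4) (hb1 : b ≤ 1 + 3 * η / 2) (hb : TailDecay f M s₀ b) :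
    TailDecay f M s₀ (b - η ^ 2 / 4) := by
  obtain ⟨c, hc, H⟩ := hb
  obtain ⟨N₀, hN₀⟩ := eventually_atTop.1 H
  have hb0 : 0 ≤ b := by nlinarith [sq_nonneg η]
  set c' : ℝ := min (c / 4) (η ^ 3 / 256) with hc'
  have hc'0 : 0 < c' := lt_min (by positivity) (by positivity)
  obtain ⟨Q, hQ⟩ := exists_nat_gt (4 / η)
  refine ⟨c', hc'0, ?_⟩
  filter_upwards [eventually_succ_mul_exp_le hc'0, eventually_ge_atTop Q,
    eventually_ge_atTop (2 * (N₀ + M) + 1)] with N hexp hNQ hNM s hs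
  have hN0 : (0 : ℝ) < N := by exact_mod_cast (by omega : 0 < N)
  have hηN : 4 < η * N := by
    have : (Q : ℝ) ≤ N := by exact_mod_cast hNQ
    rw [div_lt_iff₀' hη0] at hQ; nlinarith
  set t := ⌊η / 2 * N⌋₊ with ht
  have ht1 : (t : ℝ) ≤ η / 2 * N := Nat.floor_le (by positivity)
  have ht2 : η / 2 * N < t + 1 := Nat.lt_floor_add_one _
  have ht0 : 0 < t := by
    have : (0 : ℝ) < t := by linarith
    exact_mod_cast this
  have ht3 : 2 * t ≤ N := by
    have : (2 * t : ℝ) ≤ N := by nlinarith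
    exact_mod_cast this
  obtain ⟨n, hn⟩ := Nat.exists_eq_add_of_le (show t ≤ N by omega)
  rw [add_comm] at hn
  have hnc : (N : ℝ) = n + t := by exact_mod_cast hn
  have hn2 : N ≤ 2 * n := by omega
  have hn2' : (N : ℝ) ≤ 2 * n := by exact_mod_cast hn2
  have hn0 : (0 : ℝ) < n := by linarith
  obtain ⟨s', hs1, hs2, hle⟩ := exists_law_le hf h (show M ≤ n by omega) t s
  rw [← hn] at hle
  have htN : (t : ℝ) + 1 ≤ N + 1 := by
    have : (t : ℝ) ≤ N := by exact_mod_cast (by omega : t ≤ N)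
    linarith
  have hgoal : law f M s₀ n s' * trans f n s' t s ≤ Real.exp (-(2 * c' * N)) := by
    rcases Nat.lt_or_ge n s' with hns | hns
    · rw [law_eq_zero_of_gt f h (by omega) hns, zero_mul]; positivity
    have hl0 := law_nonneg hf h n s'
    have hl1 := law_le_one hf h n s'
    have ht0' := trans_nonneg hf t (n := n) (s := s') s hns
    have ht1' := trans_le_one hf t (n := n) (s := s') s hns
    -- Either the density at the time `n` already exceeds `b`, or the drift fails to push it down.
    rcases le_or_gt (b * n) s' with hcase | hcase
    · refine (mul_le_of_le_one_right hl0 ht1').trans ((hN₀ n (by omega) s' hcase).trans ?_)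
      rw [Real.exp_le_exp]
      have : c' * N ≤ c / 4 * (2 * n) :=
        mul_le_mul (min_le_left _ _) hn2' hN0.le (by positivity)
      linarith
    · refine (mul_le_of_le_one_left ht0' hl1).trans ?_
      obtain ⟨r, rfl⟩ := Nat.exists_eq_add_of_le hs1
      have hrt : (r : ℝ) ≤ t := by exact_mod_cast (by omega : r ≤ t)
      have hsc : ((s' + r : ℕ) : ℝ) = s' + r := by push_cast; ring
      rw [hsc] at hs
      have hs'n : (s' : ℝ) ≤ n := by exact_mod_cast hns
      -- All densities on the way lie in `[a, b + η / 2]`: from below `a` there is no time to reach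
      -- `s`.
      have hdens : ∀ j < t, ∀ i ≤ j,
          f (((s' + i : ℕ) : ℝ) / ((n + j : ℕ) : ℝ)) ≤ b + η / 2 - 2 * η := by
        intro j hj i hi
        have hd : (0 : ℝ) < ((n + j : ℕ) : ℝ) := by push_cast; positivity
        have hi' : (i : ℝ) ≤ j := by exact_mod_cast hi
        have hj' : (j : ℝ) ≤ t := by exact_mod_cast hj.le
        have hi0 : (0 : ℝ) ≤ i := Nat.cast_nonneg _
        have z1 : a ≤ ((s' + i : ℕ) : ℝ) / ((n + j : ℕ) : ℝ) := by
          rw [le_div_iff₀ hd]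
          have : a * ((n + j : ℕ) : ℝ) ≤ a * N := by
            rw [hnc]; push_cast; gcongr
          have : (a + η / 2) * N ≤ (b - η ^ 2 / 4) * N := by gcongr
          push_cast at *
          linarith
        have z2 : ((s' + i : ℕ) : ℝ) / ((n + j : ℕ) : ℝ) ≤ 1 :=
          (div_mem_unit (by omega)).2
        have z3 : ((s' + i : ℕ) : ℝ) / ((n + j : ℕ) : ℝ) ≤ b + η / 2 := by
          have w1 : ((s' + i : ℕ) : ℝ) / ((n + j : ℕ) : ℝ) ≤ (s' + t) / N := by
            rw [div_le_div_iff₀ hd hN0, hnc]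
            push_cast
            have : (i : ℝ) * (n + t) ≤ j * (n + t) := by gcongr
            nlinarith [mul_nonneg (sub_nonneg.2 hs'n) (sub_nonneg.2 hj')]
          refine w1.trans ?_
          rw [div_le_iff₀ hN0]
          have : b * n ≤ b * N := by gcongr; linarith [Nat.cast_nonneg (α := ℝ) t]
          linarith
        linarith [hdrift _ z1 z2]
      have hq0 : 0 ≤ b + η / 2 - 2 * η := by
        have := hdens 0 ht0 0 le_rfl
        simp only [add_zero] at this
        exact (hf.frac_nonneg hns).trans this
      have hr : (b + η / 2 - 2 * η + η / 2) * t ≤ r := by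
        have w1 : b * n + r ≥ (b - η ^ 2 / 4) * N := by linarith
        have w2 : η ^ 2 / 4 * N ≤ η * t := by
          have : η / 4 * N ≤ t := by linarith
          calc η ^ 2 / 4 * N = η * (η / 4 * N) := by ring
            _ ≤ η * t := by gcongr
        rw [hnc] at w1 w2
        linarith
      refine (trans_le_exp hf hq0 (by linarith) hη0 hη1 hns hr hdens).trans ?_
      rw [Real.exp_le_exp]
      have w3 : η / 4 * N ≤ t := by linarith
      have w4 : η ^ 2 / 32 * (η / 4 * N) ≤ η ^ 2 / 32 * t := by gcongr
      have w5 : c' * N ≤ η ^ 3 / 256 * N := by gcongr; exact min_le_right _ _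
      have : 2 * (η ^ 3 / 256 * N) = η ^ 2 / 32 * (η / 4 * N) := by ring
      linarith
  refine hle.trans (le_trans ?_ hexp)
  exact mul_le_mul htN hgoal
    (by
      rcases Nat.lt_or_ge n s' with hns | hns
      · rw [law_eq_zero_of_gt f h (by omega) hns, zero_mul]
      · exact mul_nonneg (law_nonneg hf h _ _) (trans_nonneg hf _ _ hns)) (by positivity)

theorem tailDecay_of_drift (hf : IsRegularUrn f k) {M s₀ : ℕ} (h : s₀ ≤ M) {a η : ℝ} (ha : 0 ≤ a)
    (hη0 : 0 < η) (hη1 : η ≤ 1) (hdrift : ∀ z, a ≤ z → z ≤ 1 → f z ≤ z - 2 * η) :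
    TailDecay f M s₀ (a + η / 2) := by
  -- Densities above `1` are impossible, and finitely many steps lead from `1 + η` down.
  have hind : ∀ i : ℕ, ∀ b, a + η / 2 ≤ b → 1 + η - i * (η ^ 2 / 4) ≤ b → TailDecay f M s₀ b := by
    intro i
    induction i with
    | zero =>
      intro b _ hb
      exact tailDecay_of_one_lt f h (by simp at hb; linarith)
    | succ i ih =>
      intro b hab hb
      rcases le_or_gt (1 + η) b with hb1 | hb1
      · exact tailDecay_of_one_lt f h (by linarith)
      have hsq : 0 < η ^ 2 / 4 := by positivity
      have hsq' : η ^ 2 / 4 ≤ η / 4 := by nlinarith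
      have := (ih (b + η ^ 2 / 4) (by linarith) (by push_cast at hb; linarith)).step hf h ha hη0
        hη1 hdrift (by linarith) (by linarith)
      rwa [add_sub_cancel_right] at this
  obtain ⟨i, hi⟩ := exists_nat_gt ((1 + η) / (η ^ 2 / 4))
  rw [div_lt_iff₀ (by positivity)] at hi
  exact hind i _ le_rfl (by linarith)

/-- Densities at a distance above the largest fixed point of the urn function are exponentially
unlikely. -/
theorem tailDecay_of_lt (hf : IsRegularUrn f k) {M s₀ : ℕ} (h : s₀ ≤ M) {y₀ b : ℝ} (h0 : 0 ≤ y₀)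
    (hb : y₀ < b) (hlt : ∀ z, y₀ < z → z ≤ 1 → f z < z) : TailDecay f M s₀ b := by
  rcases lt_or_ge 1 b with hb1 | hb1
  · exact tailDecay_of_one_lt f h hb1
  set a := (y₀ + b) / 2 with ha
  obtain ⟨z, hz, hmin⟩ := isCompact_Icc.exists_isMinOn (s := Icc a 1)
    ⟨a, by constructor <;> linarith⟩
    ((continuous_id.sub hf.cont).continuousOn)
  have hpos : 0 < z - f z := sub_pos.2 (hlt z (by linarith [hz.1]) hz.2)
  set η := min ((z - f z) / 2) (min 1 (b - a)) with hη
  have hη0 : 0 < η := lt_min (by linarith) (lt_min one_pos (by linarith))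
  have h1 : η ≤ (z - f z) / 2 := min_le_left _ _
  have h2 : η ≤ 1 := (min_le_right _ _).trans (min_le_left _ _)
  have h3 : η ≤ b - a := (min_le_right _ _).trans (min_le_right _ _)
  refine (tailDecay_of_drift hf h (a := a) (by linarith) hη0 h2 fun w hw hw' => ?_).mono
    (by linarith)
  have : z - f z ≤ w - f w := hmin ⟨hw, hw'⟩
  linarith

theorem limit_neg_of_eventually_le {M s₀ : ℕ} {y L c : ℝ} (hc : 0 < c)
    (hL : Tendsto (rate f M s₀ y) atTop (𝓝 L))
    (hpos : ∀ᶠ N : ℕ in atTop, 0 < law f M s₀ N ⌊y * N⌋₊)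
    (hle : ∀ᶠ N : ℕ in atTop, law f M s₀ N ⌊y * N⌋₊ ≤ Real.exp (-(c * N))) : L < 0 := by
  refine lt_of_le_of_lt (le_of_tendsto hL (b := -c) ?_) (neg_neg_of_pos hc)
  filter_upwards [hpos, hle, eventually_gt_atTop 0] with N h1 h2 hN
  rw [rate, div_le_iff₀ (by exact_mod_cast hN), Real.log_le_iff_le_exp h1]
  rwa [neg_mul]

theorem rate_limit_neg_of_lt (hf : IsRegularUrn f k) {M s₀ : ℕ} (hM : 0 < M) (h : s₀ ≤ M)
    {y₀ y L : ℝ} (h0 : 0 ≤ y₀) (hy : y₀ < y) (hy1 : y < 1) (hlt : ∀ z, y₀ < z → z ≤ 1 → f z < z)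
    (hL : Tendsto (rate f M s₀ y) atTop (𝓝 L)) : L < 0 := by
  have hy0 : 0 < y := h0.trans_lt hy
  obtain ⟨c, hc, H⟩ := tailDecay_of_lt hf h h0 (show y₀ < (y₀ + y) / 2 by linarith) hlt
  obtain ⟨e, he, -, P, -, hP⟩ := exists_law_pos hf hy0 hy1 hM h
  refine limit_neg_of_eventually_le hc hL (eventually_atTop.2 ⟨P, fun N hN =>
    (pow_pos he _).trans_le (hP N hN)⟩) ?_
  filter_upwards [H, (tendsto_floor_div hy0.le).eventually_const_lt
    (show (y₀ + y) / 2 < y by linarith), eventually_gt_atTop 0] with N h1 h2 hN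
  exact h1 _ ((lt_div_iff₀ (by exact_mod_cast hN)).1 h2).le

/-- Exchanging the colours. -/
theorem trans_flip (hsymm : ∀ x, f (1 - x) = 1 - f x) (t : ℕ) : ∀ {n s s' : ℕ}, 0 < n → s ≤ n →
    s' ≤ n + t → trans f n s t s' = trans f n (n - s) t (n + t - s') := by
  induction t with
  | zero =>
    intro n s s' _ hs hs'
    have : s = s' ↔ n - s = n + 0 - s' := by omega
    simp [trans, this]
  | succ t ih =>
    intro n s s' hn hs hs'
    have hn' : (n : ℝ) ≠ 0 := by positivity
    have e1 : (((n - s : ℕ) : ℝ)) / n = 1 - (s : ℝ) / n := by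
      rw [Nat.cast_sub hs, sub_div, div_self hn']
    simp only [trans]
    rw [e1, hsymm, ih (n := n + 1) (s := s + 1) (s' := s') (by omega) (by omega) (by omega),
      ih (n := n + 1) (s := s) (s' := s') (by omega) (by omega) (by omega),
      show n + 1 - (s + 1) = n - s by omega, show n + 1 - s = n - s + 1 by omega,
      show n + 1 + t = n + (t + 1) by omega]
    ring

theorem law_flip (hsymm : ∀ x, f (1 - x) = 1 - f x) {M s₀ N s : ℕ} (hM : 0 < M) (h : s₀ ≤ M)
    (hN : M ≤ N) (hs : s ≤ N) : law f M s₀ N s = law f M (M - s₀) N (N - s) := by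
  rw [law, law, trans_flip hsymm (N - M) hM h (by omega), show M + (N - M) - s = N - s by omega]

theorem rate_limit_neg_of_gt (hf : IsRegularUrn f k) (hsymm : ∀ x, f (1 - x) = 1 - f x)
    {M s₀ : ℕ} (hM : 0 < M) (h : s₀ ≤ M) {y₀ y L : ℝ} (h0 : 0 ≤ y₀) (hy : y₀ < 1 - y)
    (hy0 : 0 < y) (hlt : ∀ z, y₀ < z → z ≤ 1 → f z < z)
    (hL : Tendsto (rate f M s₀ y) atTop (𝓝 L)) : L < 0 := by
  have hy1 : y < 1 := by linarith
  obtain ⟨c, hc, H⟩ := tailDecay_of_lt hf (show M - s₀ ≤ M by omega) h0 hy hlt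
  obtain ⟨e, he, -, P, -, hP⟩ := exists_law_pos hf hy0 hy1 hM h
  refine limit_neg_of_eventually_le hc hL (eventually_atTop.2 ⟨P, fun N hN =>
    (pow_pos he _).trans_le (hP N hN)⟩) ?_
  filter_upwards [H, eventually_ge_atTop M] with N h1 hN
  have hle : (⌊y * N⌋₊ : ℝ) ≤ y * N := Nat.floor_le (by positivity)
  have hN0 : (0 : ℝ) ≤ N := Nat.cast_nonneg _
  have hle' : ⌊y * N⌋₊ ≤ N := by
    have : (⌊y * N⌋₊ : ℝ) ≤ N := hle.trans (mul_le_of_le_one_left hN0 hy1.le)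
    exact_mod_cast this
  rw [law_flip hsymm hM h hN hle']
  refine h1 _ ?_
  rw [Nat.cast_sub hle']
  linarith

/-! ### The law of the urn as a probability mass function -/

/-- The law of the urn, defined by its last step, conditioned on its first step. -/
theorem urnLaw_succ (π : I → I) (t : ℕ) : ∀ init : List Bool,
    urnLaw π init (t + 1) = (urnStep π init).bind fun Y => urnLaw π Y t := by
  induction t with
  | zero => intro init; simp [urnLaw]
  | succ t ih =>
    intro init
    rw [urnLaw, ih, PMF.bind_bind]
    rfl

theorem urnLaw_map_count {π : I → I} (hπ : ∀ x : I, (π x : ℝ) = f x) (hf : IsRegularUrn f k)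
    (t : ℕ) : ∀ (init : List Bool) (s : ℕ), ((urnLaw π init t).map (List.count true)) s =
      ENNReal.ofReal (trans f init.length (init.count true) t s) := by
  induction t with
  | zero =>
    intro init s
    simp only [urnLaw, PMF.pure_map, PMF.pure_apply, trans, eq_comm (a := s)]
    split_ifs <;> simp
  | succ t ih =>
    intro init s
    have hle : init.count true ≤ init.length := List.count_le_length
    have hd : ((density init : I) : ℝ) = (init.count true : ℝ) / (init.length : ℝ) := rfl
    rw [urnLaw_succ, PMF.map_bind, urnStep, PMF.bind_map, PMF.bind_apply, tsum_bool]
    simp only [Function.comp, ih, ballLaw, PMF.ofFintype_apply, cond_true, cond_false,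
      List.length_cons, List.count_cons_self, trans, hπ, hd]
    rw [List.count_cons_of_ne (by decide), ← ENNReal.ofReal_mul (hf.frac_nonneg hle),
      ← ENNReal.ofReal_mul (hf.frac_le_one hle), add_comm,
      ENNReal.ofReal_add (mul_nonneg (hf.frac_nonneg hle) (trans_nonneg hf _ _ (by omega)))
        (mul_nonneg (hf.frac_le_one hle) (trans_nonneg hf _ _ (by omega)))]

theorem length_of_mem_support (π : I → I) (init : List Bool) (t : ℕ) :
    ∀ Y ∈ (urnLaw π init t).support, Y.length = init.length + t := by
  induction t with
  | zero => intro Y hY; simp only [urnLaw, PMF.support_pure, mem_singleton_iff] at hY; simp [hY]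
  | succ t ih =>
    intro Y hY
    simp only [urnLaw, urnStep, PMF.support_bind, PMF.support_map, mem_iUnion, mem_image] at hY
    obtain ⟨Z, hZ, b, -, rfl⟩ := hY
    rw [List.length_cons, ih Z hZ]; ring

theorem densityProb_eq {π : I → I} (hπ : ∀ x : I, (π x : ℝ) = f x) (hf : IsRegularUrn f k)
    {init : List Bool} (hinit : init ≠ []) {y : ℝ} (hy : 0 ≤ y) {N : ℕ} (hN : init.length ≤ N) :
    densityProb π init y N =
      ENNReal.ofReal (law f init.length (init.count true) N ⌊y * N⌋₊) := by
  have hlen : 0 < init.length := List.length_pos_iff.2 hinit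
  have hN0 : (N : ℝ) ≠ 0 := by have : 0 < N := by omega
                               positivity
  rw [law, ← urnLaw_map_count hπ hf, densityProb, PMF.map_apply, PMF.map_apply]
  refine tsum_congr fun Y => ?_
  by_cases hY : Y ∈ (urnLaw π init (N - init.length)).support
  · have hl : Y.length = N := by rw [length_of_mem_support π init _ Y hY]; omega
    have hd : ((density Y : I) : ℝ) = (Y.count true : ℝ) / (N : ℝ) := by rw [← hl]; rfl
    have : ((⌊y * N⌋ : ℝ) / (N : ℝ) = (density Y : ℝ)) ↔ ⌊y * N⌋₊ = Y.count true := by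
      rw [hd, div_left_inj' hN0, ← natCast_floor_eq_intCast_floor (by positivity), Nat.cast_inj]
    by_cases hc : ⌊y * N⌋₊ = Y.count true
    · rw [if_pos hc, if_pos (this.2 hc)]
    · rw [if_neg hc, if_neg (mt this.1 hc)]
  · rw [PMF.mem_support_iff, not_not] at hY
    simp [hY]

theorem hasEntropyDensity_of_tendsto_rate {π : I → I} (hπ : ∀ x : I, (π x : ℝ) = f x)
    (hf : IsRegularUrn f k) {init : List Bool} (hinit : init ≠ []) {y L : ℝ} (h0 : 0 < y)
    (h1 : y < 1) (hL : Tendsto (rate f init.length (init.count true) y) atTop (𝓝 L)) :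
    HasEntropyDensity π init y L := by
  obtain ⟨c, hc, -, P, hMP, hP⟩ := exists_law_pos hf h0 h1 (List.length_pos_iff.2 hinit)
    (List.count_le_length (a := true))
  refine ((continuous_coe_real_ereal.tendsto L).comp hL).congr' ?_
  filter_upwards [eventually_ge_atTop P] with N hN
  rw [densityProb_eq hπ hf hinit h0.le (hMP.trans hN),
    ENNReal.log_ofReal_of_pos ((pow_pos hc N).trans_le (hP N hN)), Function.comp, rate,
    EReal.coe_div]

theorem hasEntropyDensity_bot {π : I → I} (hπ : ∀ x : I, (π x : ℝ) = f x)
    (hf : IsRegularUrn f k) {init : List Bool} (hinit : init ≠ []) {y : ℝ} (h0 : 0 ≤ y)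
    (h : ∀ᶠ N : ℕ in atTop, law f init.length (init.count true) N ⌊y * N⌋₊ = 0) :
    HasEntropyDensity π init y ⊥ := by
  refine tendsto_const_nhds.congr' ?_
  filter_upwards [h, eventually_ge_atTop init.length, eventually_gt_atTop 0] with N hN hN' hN0
  rw [densityProb_eq hπ hf hinit h0 hN', hN, ENNReal.ofReal_zero, ENNReal.log_zero,
    EReal.bot_div_of_pos_ne_top (by exact_mod_cast hN0) (EReal.coe_ne_top _)]

/-- The entropy density of an event that has the probability `q ^ (N - M)` at the time `N`. -/
theorem hasEntropyDensity_of_law_eq_pow {π : I → I} (hπ : ∀ x : I, (π x : ℝ) = f x)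
    (hf : IsRegularUrn f k) {init : List Bool} (hinit : init ≠ []) {y q : ℝ} (h0 : 0 ≤ y)
    (hq : 0 ≤ q) (h : ∀ᶠ N : ℕ in atTop, law f init.length (init.count true) N ⌊y * N⌋₊ =
      q ^ (N - init.length)) : HasEntropyDensity π init y (ENNReal.log (ENNReal.ofReal q)) := by
  rcases hq.eq_or_lt with rfl | hq0
  · rw [ENNReal.ofReal_zero, ENNReal.log_zero]
    refine hasEntropyDensity_bot hπ hf hinit h0 ?_
    filter_upwards [h, eventually_gt_atTop init.length] with N hN hN'
    rw [hN, zero_pow (by omega)]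
  · rw [ENNReal.log_ofReal_of_pos hq0]
    have hlim : Tendsto (fun N : ℕ => (1 - (init.length : ℝ) / N) * Real.log q) atTop
        (𝓝 (Real.log q)) := by
      have := ((tendsto_const_div_atTop_nhds_zero_nat (init.length : ℝ)).const_sub 1).mul_const
        (Real.log q)
      simpa using this
    refine ((continuous_coe_real_ereal.tendsto _).comp hlim).congr' ?_
    filter_upwards [h, eventually_ge_atTop init.length, eventually_gt_atTop 0] with N hN hN' hN0
    rw [densityProb_eq hπ hf hinit h0 hN', hN, ENNReal.log_ofReal_of_pos (pow_pos hq0 _),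
      Real.log_pow, ← EReal.coe_div, Function.comp, Nat.cast_sub hN']
    congr 1
    field_simp

theorem trans_zero_zero (f : ℝ → ℝ) (t : ℕ) : ∀ n : ℕ, trans f n 0 t 0 = (1 - f 0) ^ t := by
  induction t with
  | zero => intro n; simp [trans]
  | succ t ih => intro n; simp [trans, ih, trans_eq_zero_of_lt f t (s := 1) one_pos, pow_succ']

theorem trans_self_add (f : ℝ → ℝ) (t : ℕ) :
    ∀ n : ℕ, 0 < n → trans f n n t (n + t) = f 1 ^ t := by
  induction t with
  | zero => intro n _; simp [trans]
  | succ t ih =>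
    intro n hn
    have : (n : ℝ) ≠ 0 := by positivity
    have h1 := ih (n + 1) (by omega)
    rw [show n + 1 + t = n + (t + 1) by omega] at h1
    simp [trans, h1, trans_eq_zero_of_gt f t (s := n) (show n + t < n + (t + 1) by omega),
      pow_succ', div_self this]

/-! ### The urn functions with one and with three extractions -/

/-- The urn function `π_k` as a function of a real variable. -/
noncomputable def realUrnFunction (k : ℕ) (p x : ℝ) : ℝ :=
  p * majorityPoly k x + (1 - p) * (1 - majorityPoly k x)

theorem majorityPoly_one (x : ℝ) : majorityPoly 1 x = x := by
  simp [majorityPoly, Finset.sum_filter, Finset.sum_range_succ]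

theorem majorityPoly_three (x : ℝ) : majorityPoly 3 x = 3 * x ^ 2 * (1 - x) + x ^ 3 := by
  simp [majorityPoly, Finset.sum_filter, Finset.sum_range_succ]

theorem realUrnFunction_one_sub (hk : k = 1 ∨ k = 3) (p x : ℝ) :
    realUrnFunction k p (1 - x) = 1 - realUrnFunction k p x := by
  rcases hk with rfl | rfl <;> simp only [realUrnFunction, majorityPoly_one, majorityPoly_three] <;>
    ring

theorem majorityPoly_scale (hk : k = 1 ∨ k = 3) {u v c : ℝ} (hu0 : 0 ≤ u) (hu1 : u ≤ 1)
    (hc : 0 ≤ c) (h1 : c * u ≤ v) (h2 : c * (1 - u) ≤ 1 - v) :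
    c ^ k * majorityPoly k u ≤ majorityPoly k v ∧
      c ^ k * (1 - majorityPoly k u) ≤ 1 - majorityPoly k v := by
  have hu1' : 0 ≤ 1 - u := by linarith
  have g1 : 0 ≤ c * u := by positivity
  have g2 : 0 ≤ c * (1 - u) := by positivity
  rcases hk with rfl | rfl
  · simp only [majorityPoly_one, pow_one]
    exact ⟨h1, h2⟩
  · simp only [majorityPoly_three]
    constructor
    · calc c ^ 3 * (3 * u ^ 2 * (1 - u) + u ^ 3)
          = 3 * (c * u) ^ 2 * (c * (1 - u)) + (c * u) ^ 3 := by ring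
        _ ≤ 3 * v ^ 2 * (1 - v) + v ^ 3 := by gcongr
    · calc c ^ 3 * (1 - (3 * u ^ 2 * (1 - u) + u ^ 3))
          = 3 * (c * u) * (c * (1 - u)) ^ 2 + (c * (1 - u)) ^ 3 := by ring
        _ ≤ 3 * v * (1 - v) ^ 2 + (1 - v) ^ 3 := by
          have := g1.trans h1
          gcongr
        _ = _ := by ring

theorem isRegularUrn_realUrnFunction (hk : k = 1 ∨ k = 3) {p : ℝ} (hp0 : 0 ≤ p) (hp1 : p < 1) :
    IsRegularUrn (realUrnFunction k p) k where
  nonneg x h0 h1 := (urnFunction k ⟨p, hp0, hp1.le⟩ ⟨x, h0, h1⟩).2.1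
  le_one x h0 h1 := (urnFunction k ⟨p, hp0, hp1.le⟩ ⟨x, h0, h1⟩).2.2
  zero_pos := by
    rcases hk with rfl | rfl <;>
      simp [realUrnFunction, majorityPoly_one, majorityPoly_three, hp1]
  one_lt := by
    rcases hk with rfl | rfl <;>
      simp [realUrnFunction, majorityPoly_one, majorityPoly_three, hp1]
  scale u v c hu0 hu1 hc h1 h2 := by
    obtain ⟨g1, g2⟩ := majorityPoly_scale hk hu0 hu1 hc h1 h2
    have e1 := mul_le_mul_of_nonneg_left g1 hp0
    have e2 := mul_le_mul_of_nonneg_left g2 hp0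
    have e3 := mul_le_mul_of_nonneg_left g1 (sub_nonneg.2 hp1.le)
    have e4 := mul_le_mul_of_nonneg_left g2 (sub_nonneg.2 hp1.le)
    constructor <;> simp only [realUrnFunction] <;> linarith
  cont := by
    change Continuous fun x => realUrnFunction k p x
    rcases hk with rfl | rfl <;>
      simp only [realUrnFunction, majorityPoly_one, majorityPoly_three] <;> fun_prop

theorem realUrnFunction_half (hk : k = 1 ∨ k = 3) (p : ℝ) :
    realUrnFunction k p (1 / 2) = 1 / 2 := by
  have := realUrnFunction_one_sub hk p (1 / 2)
  norm_num at this ⊢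
  linarith

/-- Up to the critical value the drift above `1 / 2` is negative. -/
theorem realUrnFunction_lt_of_subcritical (hk : k = 1 ∨ k = 3) {p : ℝ} (hp1 : p < 1)
    (hsub : k = 1 ∨ p ≤ 5 / 6) {x : ℝ} (hx : 1 / 2 < x) (hx1 : x ≤ 1) :
    realUrnFunction k p x < x := by
  have hx0 : 0 < x - 1 / 2 := by linarith
  rcases hk with rfl | rfl
  · have : realUrnFunction 1 p x - x = -(2 * (1 - p) * (x - 1 / 2)) := by
      simp only [realUrnFunction, majorityPoly_one]; ring
    have : 0 < 2 * (1 - p) * (x - 1 / 2) := mul_pos (by linarith) hx0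
    linarith
  · have hp : p ≤ 5 / 6 := hsub.resolve_left (by norm_num)
    have e : realUrnFunction 3 p x - x =
        -((x - 1 / 2) * (1 - (2 * p - 1) * (3 / 2 - 2 * (x - 1 / 2) ^ 2))) := by
      simp only [realUrnFunction, majorityPoly_three]; ring
    have h1 : 0 < (x - 1 / 2) ^ 2 := by positivity
    have h2 : (x - 1 / 2) ^ 2 ≤ 1 / 4 := by nlinarith
    have h3 : (2 * p - 1) * (3 / 2 - 2 * (x - 1 / 2) ^ 2) < 1 := by nlinarith
    have : 0 < (x - 1 / 2) * (1 - (2 * p - 1) * (3 / 2 - 2 * (x - 1 / 2) ^ 2)) :=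
      mul_pos hx0 (by linarith)
    linarith

/-- Above the critical value the drift factors through the three fixed points. -/
theorem realUrnFunction_sub_self {p : ℝ} (hp : 5 / 6 < p) (x : ℝ) :
    realUrnFunction 3 p x - x =
      2 * (2 * p - 1) * (x - 1 / 2) * (yPlus p - x) * (x - yMinus p) := by
  have h : 0 < 2 * p - 1 := by linarith
  have hw : √((6 * p - 5) / (2 * p - 1)) ^ 2 * (2 * p - 1) = 6 * p - 5 := by
    rw [Real.sq_sqrt (div_nonneg (by linarith) h.le), div_mul_cancel₀ _ h.ne']
  simp only [realUrnFunction, majorityPoly_three, yPlus, yMinus]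
  linear_combination (-(x - 1 / 2) / 2) * hw

theorem yPlus_mem {p : ℝ} (hp : 5 / 6 < p) (hp1 : p < 1) : 1 / 2 < yPlus p ∧ yPlus p < 1 := by
  have h : 0 < 2 * p - 1 := by linarith
  have h0 : 0 < √((6 * p - 5) / (2 * p - 1)) := Real.sqrt_pos.2 (div_pos (by linarith) h)
  have h1 : √((6 * p - 5) / (2 * p - 1)) < 1 := by
    rw [Real.sqrt_lt' one_pos, one_pow, div_lt_one h]; linarith
  constructor <;> simp only [yPlus] <;> linarith

theorem yMinus_eq (p : ℝ) : yMinus p = 1 - yPlus p := by simp only [yMinus, yPlus]; ring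

end ElephantUrn

open ElephantUrn in
theorem mainTheorem2 (k : ℕ) (hk : k = 1 ∨ k = 3) (p : unitInterval) (hp : p < 1) :
    ∃ φ : ℝ → EReal,
      -- the limit exists, for every initial history, and is finite for `0 < y < 1`
      (∀ init : List Bool, init ≠ [] → ∀ y ∈ Set.Icc (0 : ℝ) 1,
        (y = 0 → true ∉ init) → (y = 1 → false ∉ init) →
        ElephantUrn.HasEntropyDensity (ElephantUrn.urnFunction k p) init y (φ y)) ∧
      (∀ init : List Bool, (true ∈ init →
          ElephantUrn.HasEntropyDensity (ElephantUrn.urnFunction k p) init 0 ⊥) ∧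
        (false ∈ init →
          ElephantUrn.HasEntropyDensity (ElephantUrn.urnFunction k p) init 1 ⊥)) ∧
      (∀ y ∈ Set.Ioo (0 : ℝ) 1, φ y ≠ ⊥) ∧
      -- a single zero for `k = 1`, and for `k = 3` up to the critical value
      (k = 1 ∨ (p : ℝ) ≤ 5 / 6 →
        φ (1 / 2) = 0 ∧ ∀ y ∈ Set.Icc (0 : ℝ) 1, y ≠ 1 / 2 → φ y < 0) ∧
      -- the region of sub-linear entropy for `k = 3` above the critical value
      (k = 3 ∧ 5 / 6 < (p : ℝ) →
        (∀ y : unitInterval, ElephantUrn.urnFunction k p y = y ↔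
          (y : ℝ) = ElephantUrn.yMinus p ∨ (y : ℝ) = 1 / 2 ∨ (y : ℝ) = ElephantUrn.yPlus p) ∧
        0 < ElephantUrn.yMinus p ∧ ElephantUrn.yMinus p < 1 / 2 ∧
        1 / 2 < ElephantUrn.yPlus p ∧ ElephantUrn.yPlus p < 1 ∧
        (∀ y ∈ Set.Icc (ElephantUrn.yMinus p) (ElephantUrn.yPlus p), φ y = 0) ∧
        (∀ y ∈ Set.Icc (0 : ℝ) 1,
          y ∉ Set.Icc (ElephantUrn.yMinus p) (ElephantUrn.yPlus p) → φ y < 0)) := by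
  have hp0 : (0 : ℝ) ≤ p := p.2.1
  have hp1 : (p : ℝ) < 1 := by exact_mod_cast hp
  set f := realUrnFunction k p with hfdef
  have hf : IsRegularUrn f k := isRegularUrn_realUrnFunction hk hp0 hp1
  have hsymm : ∀ x, f (1 - x) = 1 - f x := realUrnFunction_one_sub hk p
  have hπ : ∀ x : I, (urnFunction k p x : ℝ) = f x := fun x => rfl
  have hf0 : 1 - f 0 = p := by
    rcases hk with rfl | rfl <;>
      simp [hfdef, realUrnFunction, majorityPoly_one, majorityPoly_three]
  have hf1 : f 1 = p := by
    have := hsymm 0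
    rw [sub_zero] at this
    rw [this, hf0]
  have hlim : ∀ y : ℝ, ∃ L : ℝ, 0 < y → y < 1 →
      ∀ M s₀ : ℕ, 0 < M → s₀ ≤ M → Tendsto (rate f M s₀ y) atTop (𝓝 L) := fun y => by
    by_cases h : 0 < y ∧ y < 1
    · obtain ⟨L, hL⟩ := exists_tendsto_rate hf h.1 h.2
      exact ⟨L, fun _ _ => hL⟩
    · exact ⟨0, fun h0 h1 => absurd ⟨h0, h1⟩ h⟩
  choose L hL using hlim
  have hL' : ∀ y, 0 < y → y < 1 → Tendsto (rate f 1 0 y) atTop (𝓝 (L y)) := fun y h0 h1 =>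
    hL y h0 h1 1 0 one_pos zero_le_one
  classical
  -- The values at the endpoints are those for a monochromatic initial history.
  set φ : ℝ → EReal := fun y =>
    if y = 0 ∨ y = 1 then ENNReal.log (ENNReal.ofReal p) else (L y : EReal) with hφ
  have hφin : ∀ y, 0 < y → y < 1 → φ y = L y := fun y h0 h1 =>
    if_neg (by rintro (h | h) <;> linarith)
  have hφend : ∀ y, y = 0 ∨ y = 1 → φ y < 0 := fun y h => by
    simp only [hφ, if_pos h]
    rw [ENNReal.log_lt_zero_iff]
    exact ENNReal.ofReal_lt_one.2 hp1
  -- Outside the interval `[1 - y₀, y₀]` the drift points towards it.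
  have hneg : ∀ y₀ : ℝ, 0 ≤ y₀ → (∀ z, y₀ < z → z ≤ 1 → f z < z) → ∀ y ∈ Icc (0 : ℝ) 1,
      y₀ < y ∨ y₀ < 1 - y → φ y < 0 := by
    intro y₀ h0 hlt y hy hy'
    by_cases hend : y = 0 ∨ y = 1
    · exact hφend y hend
    push Not at hend
    have y0 : 0 < y := lt_of_le_of_ne hy.1 (Ne.symm hend.1)
    have y1 : y < 1 := lt_of_le_of_ne hy.2 hend.2
    rw [hφin y y0 y1]
    rcases hy' with h | h
    · exact_mod_cast rate_limit_neg_of_lt hf one_pos zero_le_one h0 h y1 hlt (hL' y y0 y1)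
    · exact_mod_cast rate_limit_neg_of_gt hf hsymm one_pos zero_le_one h0 h y0 hlt (hL' y y0 y1)
  refine ⟨φ, ?_, ?_, ?_, ?_, ?_⟩
  · intro init hinit y hy h0 h1
    have hlen : 0 < init.length := List.length_pos_iff.2 hinit
    rcases eq_or_ne y 0 with rfl | hy0
    · rw [show φ 0 = ENNReal.log (ENNReal.ofReal p) from if_pos (Or.inl rfl)]
      refine hasEntropyDensity_of_law_eq_pow hπ hf hinit le_rfl hp0
        (Eventually.of_forall fun N => ?_)
      rw [List.count_eq_zero_of_not_mem (h0 rfl), zero_mul, Nat.floor_zero, law, trans_zero_zero,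
        hf0]
    rcases eq_or_ne y 1 with rfl | hy1
    · rw [show φ 1 = ENNReal.log (ENNReal.ofReal p) from if_pos (Or.inr rfl)]
      refine hasEntropyDensity_of_law_eq_pow hπ hf hinit zero_le_one hp0 ?_
      filter_upwards [eventually_ge_atTop init.length] with N hN
      have hc : init.count true = init.length := by
        rw [List.count_eq_length]
        intro b hb
        cases b
        · exact absurd hb (h1 rfl)
        · rfl
      have := trans_self_add f (N - init.length) init.length hlen
      rw [show init.length + (N - init.length) = N by omega] at this
      rw [hc, one_mul, Nat.floor_natCast, law, this, hf1]
    have y0 : 0 < y := lt_of_le_of_ne hy.1 (Ne.symm hy0)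
    have y1 : y < 1 := lt_of_le_of_ne hy.2 hy1
    rw [hφin y y0 y1]
    exact hasEntropyDensity_of_tendsto_rate hπ hf hinit y0 y1
      (hL y y0 y1 _ _ hlen List.count_le_length)
  · refine fun init => ⟨fun h => ?_, fun h => ?_⟩
    · refine hasEntropyDensity_bot hπ hf (List.ne_nil_of_mem h) le_rfl
        (Eventually.of_forall fun N => ?_)
      rw [zero_mul, Nat.floor_zero]
      exact trans_eq_zero_of_lt f _ (List.count_pos_iff.2 h)
    · refine hasEntropyDensity_bot hπ hf (List.ne_nil_of_mem h) zero_le_one ?_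
      filter_upwards [eventually_ge_atTop init.length] with N hN
      rw [one_mul, Nat.floor_natCast]
      have hlt : init.count true < init.length := by
        refine lt_of_le_of_ne List.count_le_length fun hc => ?_
        have := List.count_eq_length.1 hc false h
        simp at this
      exact trans_eq_zero_of_gt f _ (by omega)
  · intro y hy
    rw [hφin y hy.1 hy.2]
    exact EReal.coe_ne_bot _
  · intro hsub
    have hlt : ∀ z, 1 / 2 < z → z ≤ 1 → f z < z := fun z h0 h1 =>
      realUrnFunction_lt_of_subcritical hk hp1 hsub h0 h1
    constructor
    · have hhalf := realUrnFunction_half hk (p : ℝ)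
      rw [hφin _ (by norm_num) (by norm_num), rate_limit_eq_zero hf one_pos zero_le_one hL'
        (a := 1 / 2) (b := 1 / 2) (by norm_num) (by norm_num) hhalf hhalf _ ⟨le_rfl, le_rfl⟩]
      rfl
    · intro y hy hne
      refine hneg (1 / 2) (by norm_num) hlt y hy ?_
      rcases lt_or_gt_of_ne hne with h | h
      · right; linarith
      · left; exact h
  · rintro ⟨rfl, hcrit⟩
    obtain ⟨m1, m2⟩ := yPlus_mem hcrit hp1
    have m3 := yMinus_eq p
    have hc : 0 < 2 * (2 * (p : ℝ) - 1) := by linarith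
    have hfac := realUrnFunction_sub_self hcrit
    have hfix : ∀ x, f x = x ↔ x = yMinus p ∨ x = 1 / 2 ∨ x = yPlus p := by
      intro x
      rw [← sub_eq_zero, hfdef, hfac]
      simp only [mul_eq_zero, hc.ne', false_or, sub_eq_zero]
      constructor
      · rintro ((h | h) | h)
        · exact Or.inr (Or.inl h)
        · exact Or.inr (Or.inr h.symm)
        · exact Or.inl h
      · rintro (h | h | h)
        · exact Or.inr h
        · exact Or.inl (Or.inl h)
        · exact Or.inl (Or.inr h.symm)
    have hlt : ∀ z, yPlus p < z → z ≤ 1 → f z < z := by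
      intro z hz _
      have h1 : 0 < 2 * (2 * (p : ℝ) - 1) * (z - 1 / 2) * (z - yPlus p) * (z - yMinus p) :=
        mul_pos (mul_pos (mul_pos hc (by linarith)) (by linarith)) (by linarith)
      have h2 := hfac z
      rw [hfdef]
      linarith
    refine ⟨fun y => ?_, by linarith, by linarith, m1, m2, fun y hy => ?_, fun y hy hy' => ?_⟩
    · rw [← hfix, ← hπ, Subtype.ext_iff]
    · rw [hφin y (by linarith [hy.1]) (by linarith [hy.2]), rate_limit_eq_zero hf one_pos
        zero_le_one hL' (by linarith) m2 ((hfix _).2 (Or.inl rfl))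
        ((hfix _).2 (Or.inr (Or.inr rfl))) y hy]
      rfl
    · refine hneg (yPlus p) (by linarith) hlt y hy ?_
      rw [mem_Icc, not_and_or, not_le, not_le] at hy'
      rcases hy' with h | h
      · right; linarith
      · left; exact h
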